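/- \textbf{The protocol.} A network has $n$ nodes, of which at most $qn$ are adversarial and the others are honest. Every honest node has an initial opinion in $\{0,1\}$. The parameters are $\frac12<a\le b<1$, $\beta\in(0,\frac12)$ and integers $k,m_0,\ell\ge 1$. In each round $m=1,2,\dots$, every honest node queries independent uniformly chosen nodes (repetitions and self-queries allowed) one after the other until it has received $k$ responses, and counts the number $\eta_m$ of $1$-responses among them. Honest nodes always answer with their current opinion. Afterwards a common random threshold $X_m$, independent of everything so far, is revealed; it is uniform on $[a,b]$ for $m=1$ and on $[\beta,1-\beta]$ for $m\ge2$. Each honest node without a final opinion then adopts opinion $1$ if $\eta_m/k\ge X_m$, and opinion $0$ otherwise. An opinion that a node has held during $\ell$ consecutive rounds, counted from round $m_0+1$ on, becomes final and is never changed. The adversary is omniscient (it knows the whole past, and may use private randomness) and \emph{semi-cautious}: before each round it fixes an opinion for each of its nodes, and to each query received in that round the node either answers with this opinion or remains silent; these choices cannot depend on the threshold $X_m$ of the current round. Let $H_i$ be the event that all honest nodes eventually reach the final opinion $i$, and let $\mathcal N$ be the number of rounds until all honest nodes have final opinions. We say that \emph{the protocol works whp for $(q,\beta)$} if $k,m_0,\ell\ge1$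 and an integer $u\ge0$ can be chosen as functions of $n$, with $k(n)/n\to0$, such that $$\mathbb P\big[(H_0\cup H_1)\cap\{\mathcal N\le m_0+\ell u\}\big]\to1\qquad(n\to\infty),$$ uniformly over all numbers $f\le qn$ of adversarial nodes, all $\frac12<a\le b<1$, all initial opinions and all strategies of a semi-cautious adversary. \textbf{Corollary.} Let $\phi=\frac{1+\sqrt5}{2}$ be the Golden Ratio, so that $\phi^{-2}=\frac1{1+\phi}=\frac{3-\sqrt5}{2}\approx0.38$. (a) Let $0\le q<\beta<\frac12$. Then $\frac1{2-q}-\beta<1-2\beta$ if and only if $q<2-\frac1{1-\beta}$. This is also equivalent to the existence of an integer $k\ge1$ with $$\frac1{2-q}-\beta+\sqrt{2k^{-1}\ln\tfrac{4(1-q)}{\beta-q}}<1-2\beta,$$ and to the validity of this inequality for all sufficiently large $k$. (b) For $0<\beta<\frac12$, $\beta=2-\frac1{1-\beta}$ if and only if $\beta=\phi^{-2}$. For $q\ge0$, there is a $\beta\in(0,\frac12)$ with $q<\beta$ and $q<2-\frac1{1-\beta}$ if and only if $q<\phi^{-2}$. (c) If $0\le q<\beta<\frac12$ and $q<2-\frac1{1-\beta}$,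 then the protocol works whp for $(q,\beta)$. (d) Consequently, for a semi-cautious adversary the protocol can be tuned to work whp for every $0\le q<\phi^{-2}$: there is a $\delta>0$ such that every $\beta$ with $|\beta-\phi^{-2}|<\delta$ satisfies $0<\beta<\frac12$, $q<\beta$ and $q<2-\frac1{1-\beta}$, and the protocol works whp for $(q,\beta)$. -/

import Mathlib

open MeasureTheory Filter Topology

noncomputable section

namespace FPC

/-- The nodes of the network: `h` honest nodes and `f` adversarial ones. -/
abbrev Node (h f : ℕ) : Type := Fin h ⊕ Fin f

/-- The targets of the queries of one round: `Q j i` is the node contacted by the honest node `j`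
in the `i`-th query (`i = 0, 1, 2, …`) it issues in that round. Only the queries up to the `k`-th
received response are used by `j`. -/
abbrev Queries (h f : ℕ) : Type := Fin h → ℕ → Node h f

/-- The randomness of one round: a number in `[0, 1]` from which the common decision threshold
is made, and the targets of the queries. -/
abbrev RoundNoise (h f : ℕ) : Type := unitInterval × Queries h f

/-- The law of the randomness of one round: the common random number is uniform on `[0, 1]`, all
query targets are uniform over all nodes (repetitions and self-queries are allowed), and all of
these are independent. -/
def roundLaw (h f : ℕ) [NeZero h] : Measure (RoundNoise h f) :=
  (volume : Measure unitInterval).prod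
    (Measure.pi fun _ : Fin h => Measure.infinitePi fun _ : ℕ =>
      (PMF.uniformOfFintype (Node h f)).toMeasure)

instance (h f : ℕ) [NeZero h] : IsProbabilityMeasure (roundLaw h f) := by
  unfold roundLaw; infer_instance

/-- The underlying probability measure: the private random seed of the adversary, with law `ν`,
and the independent and identically distributed randomness of the successive rounds. -/
def law {S : Type} [MeasurableSpace S] (ν : Measure S) (h f : ℕ) [NeZero h] :
    Measure (S × (ℕ → RoundNoise h f)) :=
  ν.prod (Measure.infinitePi fun _ : ℕ => roundLaw h f)

instance {S : Type} [MeasurableSpace S] (ν : Measure S) [IsProbabilityMeasure ν] (h f : ℕ)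
    [NeZero h] : IsProbabilityMeasure (law ν h f) := by
  unfold law; infer_instance

/-- The parameters of the protocol. -/
structure Params where
  /-- lower threshold limit of the first round -/
  a : ℝ
  /-- upper threshold limit of the first round -/
  b : ℝ
  /-- in the later rounds the threshold is uniform on `[β, 1 - β]` -/
  β : ℝ
  /-- number of responses that a node collects in a round -/
  k : ℕ
  /-- cooling-off period -/
  m₀ : ℕ
  /-- number of consecutive rounds with the same opinion after which it becomes final -/
  ℓ : ℕ

/-- The decision threshold of round `t + 1`, made from a uniform number `x` on `[0, 1]`: it is
uniform on `[a, b]` in the first round and uniform on `[β, 1 - β]` in the later ones. -/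
def Params.threshold (P : Params) (t : ℕ) (x : ℝ) : ℝ :=
  if t = 0 then P.a + (P.b - P.a) * x else P.β + ((1 - P.β) - P.β) * x

/-- A strategy of an omniscient semi-cautious adversary, with a private random seed in `S`.
Before round `t + 1` it chooses the opinions of all its nodes, knowing the whole past, i.e. the
randomness of the rounds `1, …, t` (which, with the initial opinions and its own seed, determines
everything that happened). During that round it chooses, for each query that reaches one of its
nodes, whether this node answers (necessarily with its opinion) or remains silent. These choices
may depend on the past and on the queries of the round, in whatever order those are issued, but
not on the decision threshold of the round, which is revealed afterwards. -/
structure SemiCautious (S : Type) [MeasurableSpace S] (h f : ℕ) where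
  /-- the opinion of each adversarial node in round `t + 1` -/
  opinion : (t : ℕ) → S → (Fin t → RoundNoise h f) → Fin f → Bool
  /-- does the adversarial node reached by the `i`-th query of the honest node `j` answer it? -/
  answers : (t : ℕ) → S → (Fin t → RoundNoise h f) → Queries h f → Fin h → ℕ → Bool
  measurable_opinion : ∀ t,
    Measurable fun p : S × (Fin t → RoundNoise h f) => opinion t p.1 p.2
  measurable_answers : ∀ t,
    Measurable fun p : (S × (Fin t → RoundNoise h f)) × Queries h f =>
      answers t p.1.1 p.1.2 p.2

section Dynamics

variable {S : Type} [MeasurableSpace S] {h f : ℕ}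

/-- The outcome of the `i`-th query of the honest node `j` in round `t + 1`: `some c` if the
response `c` is received, `none` if the contacted node remains silent. Honest nodes, whose
current opinions are `ξ`, always answer. -/
def SemiCautious.response (A : SemiCautious S h f) (t : ℕ) (σ : S)
    (past : Fin t → RoundNoise h f) (Q : Queries h f) (ξ : Fin h → Bool)
    (j : Fin h) (i : ℕ) : Option Bool :=
  match Q j i with
  | Sum.inl v => some (ξ v)
  | Sum.inr v => if A.answers t σ past Q j i then some (A.opinion t σ past v) else none

/-- The number of `1`-responses among the first `k` responses received. -/
def onesCount (k : ℕ) (r : ℕ → Option Bool) : ℕ :=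
  {i : ℕ | r i = some true ∧ Nat.count (fun i' => (r i').isSome = true) i < k}.ncard

/-- The state of the honest nodes after `t` rounds. The first component is the opinion (`true`
for `1`). The second one is the length of the current run of rounds with this opinion, counted
from round `m₀ + 1` on. The opinion is final as soon as this length reaches `ℓ`; from then on the
node keeps it, so that the length stays at least `ℓ`. -/
def state (P : Params) (init : Fin h → Bool) (A : SemiCautious S h f) (σ : S)
    (w : ℕ → RoundNoise h f) : ℕ → Fin h → Bool × ℕ
  | 0 => fun j => (init j, 0)
  | t + 1 => fun j =>
    let prev := state P init A σ w t
    let old : Bool × ℕ := prev j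
    let η : ℕ := onesCount P.k
      (A.response t σ (fun s : Fin t => w s) (w t).2 (fun v => (prev v).1) j)
    let new : Bool :=
      if P.ℓ ≤ old.2 then old.1
      else decide (P.threshold t ((w t).1 : ℝ) ≤ (η : ℝ) / (P.k : ℝ))
    (new, if t < P.m₀ then 0 else if new = old.1 then old.2 + 1 else 1)

/-- All honest nodes eventually reach the final opinion `c`. -/
def ConsensusOn (P : Params) (init : Fin h → Bool) (A : SemiCautious S h f) (σ : S)
    (w : ℕ → RoundNoise h f) (c : Bool) : Prop :=
  ∀ j, ∃ t, P.ℓ ≤ (state P init A σ w t j).2 ∧ (state P init A σ w t j).1 = c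

/-- The number of rounds until all honest nodes have final opinions (`⊤` if this never
happens). -/
def numRounds (P : Params) (init : Fin h → Bool) (A : SemiCautious S h f) (σ : S)
    (w : ℕ → RoundNoise h f) : ℕ∞ :=
  ⨅ (t : ℕ) (_ : ∀ j, P.ℓ ≤ (state P init A σ w t j).2), (t : ℕ∞)

end Dynamics

/-- With threshold limit `β` in the rounds after the first, the numbers `k` (with `k ≪ n`), `m₀`
and `ℓ` can be chosen, as functions of the total number `n` of nodes, in such a way that with
probability tending to `1` as `n → ∞` all honest nodes finalize the same opinion, within
`m₀ + ℓ u` rounds. This is uniform over all numbers `f ≤ q n` of adversarial nodes, all threshold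
limits of the first round, all initial opinions and all semi-cautious strategies. -/
def WorksWhp (q β : ℝ) : Prop :=
  ∃ k m₀ ℓ u : ℕ → ℕ,
    (∀ n, 1 ≤ k n ∧ 1 ≤ m₀ n ∧ 1 ≤ ℓ n) ∧
    Tendsto (fun n => (k n : ℝ) / (n : ℝ)) atTop (𝓝 0) ∧
    ∀ ε : ℝ, 0 < ε → ∃ N : ℕ, ∀ n : ℕ, N ≤ n →
      ∀ (h f : ℕ) [NeZero h], h + f = n → (f : ℝ) ≤ q * (n : ℝ) →
      ∀ a b : ℝ, 1 / 2 < a → a ≤ b → b < 1 →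
      ∀ (S : Type) [MeasurableSpace S] (ν : Measure S) [IsProbabilityMeasure ν]
        (A : SemiCautious S h f) (init : Fin h → Bool),
        let P : Params := ⟨a, b, β, k n, m₀ n, ℓ n⟩
        1 - ε ≤ (law ν h f).real
          {ω | (ConsensusOn P init A ω.1 ω.2 false ∨ ConsensusOn P init A ω.1 ω.2 true) ∧
            numRounds P init A ω.1 ω.2 ≤ ((m₀ n + ℓ n * u n : ℕ) : ℕ∞)}

end FPC

end

/-! The analytic claims come from the quadratic β² - 3β + 1: clearing denominators in β = 2 - 1/(1 -
β) gives it, and φ⁻² is its root below 1/2. Since 2 - 1/(1 - β) decreases in β, the minimum of β and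
2 - 1/(1 - β) is largest where the two cross.

For the protocol, fix the opinions held in a round. By choosing who stays silent, the adversary can
move the proportion of 1-responses essentially only between `lowerRatio` (its 1-holders silent) and
`upperRatio` (its 0-holders silent). By Hoeffding's inequality and a union bound, all the
proportions η/k lie within 2ε of this interval, except with probability of order h·exp(-kε²)
(`onesCount_response_bounds`).

The inequality q(1 - β) < 1 - 2β, equivalent to q < 2 - 1/(1 - β), makes it impossible that the
interval nearly covers [β, 1 - β] (`upperRatio_le_of_lowerRatio_lt`). So a threshold close to one of
the two ends, and that end is determined before the threshold is drawn, makes all honest nodes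
agree; this has probability at least ε. Once reached, unanimity survives every threshold because q <
β (`unanimous_succ`). The probability p of disagreement therefore obeys p' ≤ (1 - ε)p + error
(`law_real_not_unanimous_succ_le`).

It remains to take a long cooling-off period m₀, in which no opinion becomes final, with ℓ = 1:
whatever is unanimous after round m₀ + 1 is final at once (`consensus_of_unanimous`). -/

noncomputable section

namespace FPC

/-! ### Counting responses under selective silence -/

/-- The indices of the first `k` responses. -/
def firstResponses (k : ℕ) (r : ℕ → Option Bool) : Set ℕ :=
  {i | (r i).isSome = true ∧ Nat.count (fun i' => (r i').isSome = true) i < k}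

lemma count_injOn_firstResponses (k : ℕ) (r : ℕ → Option Bool) :
    Set.InjOn (Nat.count fun i' => (r i').isSome = true) (firstResponses k r) :=
  fun _ hi _ hj hij => Nat.count_injective hi.1 hj.1 hij

lemma finite_firstResponses (k : ℕ) (r : ℕ → Option Bool) : (firstResponses k r).Finite :=
  Set.Finite.of_injOn (t := Set.Iio k) (fun _ hi => hi.2) (count_injOn_firstResponses k r)
    (Set.finite_Iio k)

lemma ncard_firstResponses_le (k : ℕ) (r : ℕ → Option Bool) :
    (firstResponses k r).ncard ≤ k := by
  have h := Set.ncard_le_ncard_of_injOn (t := Set.Iio k) _ (fun _ hi => hi.2)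
    (count_injOn_firstResponses k r) (Set.finite_Iio k)
  simpa [Set.ncard_eq_toFinset_card'] using h

/-- The indices of the responses `v` among the first `k` responses. -/
def firstResponsesOf (k : ℕ) (r : ℕ → Option Bool) (v : Bool) : Set ℕ :=
  {i | r i = some v ∧ Nat.count (fun i' => (r i').isSome = true) i < k}

lemma onesCount_eq (k : ℕ) (r : ℕ → Option Bool) :
    onesCount k r = (firstResponsesOf k r true).ncard := rfl

lemma firstResponsesOf_subset (k : ℕ) (r : ℕ → Option Bool) (v : Bool) :
    firstResponsesOf k r v ⊆ firstResponses k r := by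
  rintro i ⟨h1, h2⟩
  exact ⟨by simp [h1], h2⟩

lemma finite_firstResponsesOf (k : ℕ) (r : ℕ → Option Bool) (v : Bool) :
    (firstResponsesOf k r v).Finite :=
  (finite_firstResponses k r).subset (firstResponsesOf_subset k r v)

lemma onesCount_add_eq (k : ℕ) (r : ℕ → Option Bool) :
    onesCount k r + (firstResponsesOf k r false).ncard = (firstResponses k r).ncard := by
  rw [onesCount_eq, ← Set.ncard_union_eq _ (finite_firstResponsesOf k r true)
    (finite_firstResponsesOf k r false)]
  · congr 1
    ext i
    simp only [firstResponsesOf, firstResponses, Set.mem_union, Set.mem_ofPred_eq]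
    rcases r i with _ | (_ | _) <;> simp
  · rw [Set.disjoint_left]
    rintro i ⟨h1, _⟩ ⟨h2, _⟩
    simp [h1] at h2

lemma ncard_firstResponsesOf_le_of_subset_range {k N : ℕ} {r : ℕ → Option Bool} {v : Bool}
    {p : ℕ → Prop} [DecidablePred p] (hp : ∀ i, r i = some v → p i)
    (h : ∀ i ∈ firstResponses k r, i < N) :
    (firstResponsesOf k r v).ncard ≤ ((Finset.range N).filter p).card := by
  rw [← Set.ncard_coe_finset]
  refine Set.ncard_le_ncard (fun i hi => ?_) (Finset.finite_toSet _)
  simpa using ⟨h i (firstResponsesOf_subset k r v hi), hp i hi.1⟩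

lemma le_ncard_firstResponsesOf {k N : ℕ} {r : ℕ → Option Bool} {v : Bool}
    {p : ℕ → Prop} [DecidablePred p] (hp : ∀ i, p i → r i = some v)
    (h : ∀ i < N, Nat.count (fun i' => (r i').isSome = true) i < k) :
    ((Finset.range N).filter p).card ≤ (firstResponsesOf k r v).ncard := by
  rw [← Set.ncard_coe_finset]
  refine Set.ncard_le_ncard (fun i hi => ?_) (finite_firstResponsesOf k r v)
  simp only [Finset.coe_filter, Finset.mem_range, Set.mem_ofPred_eq] at hi
  exact ⟨hp i hi.2, h i hi.1⟩

/-- Either the first `k` responses are all received within `N` queries, or none of the responses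
received within `N` queries is discarded. -/
lemma firstResponses_dichotomy (k N : ℕ) (r : ℕ → Option Bool) :
    ((∀ i ∈ firstResponses k r, i < N) ∧ (firstResponses k r).ncard = k) ∨
      ∀ i < N, Nat.count (fun i' => (r i').isSome = true) i < k := by
  rcases lt_or_ge (Nat.count (fun i' => (r i').isSome = true) N) k with h | h
  · exact Or.inr fun i hi => (Nat.count_monotone _ hi.le).trans_lt h
  · have hlt : ∀ i ∈ firstResponses k r, i < N := fun i hi => by
      by_contra! hN
      exact absurd hi.2 (not_lt.mpr (h.trans (Nat.count_monotone _ hN)))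
    refine Or.inl ⟨hlt, (ncard_firstResponses_le k r).antisymm ?_⟩
    -- Each rank m < k is realized by the m-th response; `hcard` covers the case of only finitely
    -- many responses in total.
    have hsub : Set.Iio k ⊆
        (Nat.count fun i' => (r i').isSome = true) '' firstResponses k r := fun m hm => by
      have hcard : ∀ hf : (Set.ofPred fun i' => (r i').isSome = true).Finite,
          m < hf.toFinset.card := fun hf =>
        (Set.mem_Iio.mp hm).trans_le (h.trans (Nat.count_le_card hf N))
      refine ⟨Nat.nth (fun i' => (r i').isSome = true) m, ⟨Nat.nth_mem m hcard, ?_⟩,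
        Nat.count_nth hcard⟩
      rw [Nat.count_nth hcard]
      exact hm
    have := (Set.ncard_le_ncard hsub ((finite_firstResponses k r).image _)).trans
      (Set.ncard_image_le (finite_firstResponses k r))
    simpa [Set.ncard_eq_toFinset_card'] using this

/-- If collection stops within N queries, the ones are among the p-queries; otherwise every z-query
before N is a counted zero, leaving at most k minus their number. With p and z read off from the
query targets, the bound is independent of the adversary's choice of answers, however these depend
on the queries. -/
lemma onesCount_upper {k : ℕ} {r : ℕ → Option Bool} (N : ℕ) {p z : ℕ → Prop} [DecidablePred p]
    [DecidablePred z] (hp : ∀ i, r i = some true → p i) (hz : ∀ i, z i → r i = some false) :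
    onesCount k r ≤ ((Finset.range N).filter p).card ∨
      onesCount k r + ((Finset.range N).filter z).card ≤ k := by
  rcases firstResponses_dichotomy k N r with ⟨h, -⟩ | h
  · exact Or.inl (ncard_firstResponsesOf_le_of_subset_range hp h)
  · have h1 := le_ncard_firstResponsesOf hz h
    have h2 := onesCount_add_eq k r
    have h3 := ncard_firstResponses_le k r
    omega

/-- The mirror image of `onesCount_upper`. Here the first case needs that exactly k responses are
received, since the zeros are subtracted from k. -/
lemma onesCount_lower {k : ℕ} {r : ℕ → Option Bool} (N : ℕ) {p z : ℕ → Prop} [DecidablePred p]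
    [DecidablePred z] (hp : ∀ i, p i → r i = some true) (hz : ∀ i, r i = some false → z i) :
    ((Finset.range N).filter p).card ≤ onesCount k r ∨
      k ≤ onesCount k r + ((Finset.range N).filter z).card := by
  rcases firstResponses_dichotomy k N r with ⟨h, hk⟩ | h
  · have h1 := ncard_firstResponsesOf_le_of_subset_range hz h
    have h2 := onesCount_add_eq k r
    omega
  · exact Or.inl (le_ncard_firstResponsesOf hp h)

/-! ### Measurability of the dynamics -/

/-- The number of `1`-responses is the supremum of the numbers found by looking at finitely many
queries only. -/
lemma le_onesCount_iff (k m : ℕ) (r : ℕ → Option Bool) :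
    m ≤ onesCount k r ↔ ∃ N : ℕ, m ≤ ((Finset.range N).filter fun i => r i = some true ∧
      ((Finset.range i).filter fun i' => (r i').isSome = true).card < k).card := by
  have hcard : ∀ N : ℕ, ((Finset.range N).filter fun i => r i = some true ∧
      ((Finset.range i).filter fun i' => (r i').isSome = true).card < k).card =
      (firstResponsesOf k r true ∩ Set.Iio N).ncard := fun N => by
    rw [← Set.ncard_coe_finset]
    congr 1
    ext i
    simp [firstResponsesOf, Nat.count_eq_card_filter_range, and_comm]
  simp_rw [hcard, onesCount_eq]
  have hfin := finite_firstResponsesOf k r true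
  constructor
  · intro h
    obtain ⟨B, hB⟩ := hfin.bddAbove
    refine ⟨B + 1, ?_⟩
    have hsub : firstResponsesOf k r true ⊆ Set.Iio (B + 1) := fun i hi =>
      Nat.lt_succ_of_le (hB hi)
    rwa [Set.inter_eq_left.mpr hsub]
  · rintro ⟨N, hN⟩
    exact hN.trans (Set.ncard_le_ncard Set.inter_subset_left hfin)

lemma measurable_card_filter_range {α : Type*} [MeasurableSpace α] {p : α → ℕ → Prop}
    [∀ a, DecidablePred (p a)] (hp : ∀ i, MeasurableSet {a | p a i}) (N : ℕ) :
    Measurable fun a => ((Finset.range N).filter (p a)).card := by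
  simp_rw [Finset.card_filter]
  exact Finset.measurable_sum _ fun i _ => Measurable.ite (hp i) measurable_const measurable_const

lemma measurable_onesCount {α : Type*} [MeasurableSpace α] (k : ℕ) {r : α → ℕ → Option Bool}
    (hr : ∀ i v, MeasurableSet {a | r a i = v}) : Measurable fun a => onesCount k (r a) := by
  refine measurable_of_Ici fun m => ?_
  have hset : (fun a => onesCount k (r a)) ⁻¹' Set.Ici m =
      ⋃ N : ℕ, {a | m ≤ ((Finset.range N).filter fun i => r a i = some true ∧
        ((Finset.range i).filter fun i' => (r a i').isSome = true).card < k).card} := by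
    ext a
    simp [le_onesCount_iff]
  rw [hset]
  refine MeasurableSet.iUnion fun N => ?_
  refine measurableSet_le measurable_const (measurable_card_filter_range (fun i => ?_) N)
  refine (hr i _).inter (measurableSet_lt (measurable_card_filter_range (fun i' => ?_) i)
    measurable_const)
  have : {a | (r a i').isSome = true} = {a | r a i' = none}ᶜ := by
    ext a
    simp [Option.isSome_iff_ne_none]
  rw [this]
  exact (hr i' _).compl

instance (h f : ℕ) : DiscreteMeasurableSpace (Node h f) where
  forall_measurableSet _ := measurableSet_sum_iff.mpr ⟨.of_discrete, .of_discrete⟩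

section Measurability

variable {S : Type} [MeasurableSpace S] {h f : ℕ}

lemma measurableSet_response (A : SemiCautious S h f) (t : ℕ) {α : Type*} [MeasurableSpace α]
    {σ : α → S} {past : α → Fin t → RoundNoise h f} {Q : α → Queries h f} {ξ : α → Fin h → Bool}
    (hσ : Measurable σ) (hpast : Measurable past) (hQ : Measurable Q) (hξ : Measurable ξ)
    (j : Fin h) (i : ℕ) (v : Option Bool) :
    MeasurableSet {a | A.response t (σ a) (past a) (Q a) (ξ a) j i = v} := by
  have hop : Measurable fun a => A.opinion t (σ a) (past a) :=
    (A.measurable_opinion t).comp (hσ.prodMk hpast)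
  have hans : Measurable fun a => A.answers t (σ a) (past a) (Q a) j i := by
    have := (A.measurable_answers t).comp ((hσ.prodMk hpast).prodMk hQ)
    exact (measurable_pi_apply i).comp ((measurable_pi_apply j).comp this)
  have hQji : Measurable fun a => Q a j i :=
    (measurable_pi_apply i).comp ((measurable_pi_apply j).comp hQ)
  -- The response factors through a finite discrete space, on which every set is measurable.
  let g : Node h f × Bool × (Fin h → Bool) × (Fin f → Bool) → Option Bool := fun x =>
    match x.1 with
    | Sum.inl u => some (x.2.2.1 u)
    | Sum.inr u => if x.2.1 then some (x.2.2.2 u) else none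
  have hg : {a | A.response t (σ a) (past a) (Q a) (ξ a) j i = v} =
      (fun a => (Q a j i, A.answers t (σ a) (past a) (Q a) j i, ξ a,
        A.opinion t (σ a) (past a))) ⁻¹' (g ⁻¹' {v}) := rfl
  rw [hg]
  exact (hQji.prodMk (hans.prodMk (hξ.prodMk hop))) .of_discrete

lemma measurable_state (P : Params) (init : Fin h → Bool) (A : SemiCautious S h f) (t : ℕ) :
    Measurable fun p : S × (ℕ → RoundNoise h f) => state P init A p.1 p.2 t := by
  induction t with
  | zero => exact measurable_const
  | succ t ih =>
    have hop : Measurable fun p : S × (ℕ → RoundNoise h f) =>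
        fun v => (state P init A p.1 p.2 t v).1 :=
      measurable_pi_lambda _ fun v => measurable_fst.comp ((measurable_pi_apply v).comp ih)
    refine measurable_pi_lambda _ fun j => ?_
    have hold : Measurable fun p : S × (ℕ → RoundNoise h f) => state P init A p.1 p.2 t j :=
      (measurable_pi_apply j).comp ih
    have hη : Measurable fun p : S × (ℕ → RoundNoise h f) => onesCount P.k
        (A.response t p.1 (fun s : Fin t => p.2 s) (p.2 t).2
          (fun v => (state P init A p.1 p.2 t v).1) j) := by
      refine measurable_onesCount _ fun i v => measurableSet_response A t measurable_fst ?_ ?_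
        hop j i v
      · fun_prop
      · fun_prop
    have hthr : Measurable fun p : S × (ℕ → RoundNoise h f) =>
        P.threshold t ((p.2 t).1 : ℝ) := by
      unfold Params.threshold
      split_ifs <;> fun_prop
    have hdec : Measurable fun p : S × (ℕ → RoundNoise h f) =>
        (state P init A p.1 p.2 t j, decide (P.threshold t ((p.2 t).1 : ℝ) ≤
          (onesCount P.k (A.response t p.1 (fun s : Fin t => p.2 s) (p.2 t).2
            (fun v => (state P init A p.1 p.2 t v).1) j) : ℝ) / (P.k : ℝ))) := by
      refine hold.prodMk (measurable_to_bool ?_)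
      have hle : MeasurableSet {p : S × (ℕ → RoundNoise h f) |
          P.threshold t ((p.2 t).1 : ℝ) ≤
          (onesCount P.k (A.response t p.1 (fun s : Fin t => p.2 s) (p.2 t).2
            (fun v => (state P init A p.1 p.2 t v).1) j) : ℝ) / (P.k : ℝ)} :=
        measurableSet_le hthr ((measurable_from_top.comp hη).div_const _)
      convert hle using 1
      ext p
      simp
    let g : (Bool × ℕ) × Bool → Bool × ℕ := fun x =>
      (if P.ℓ ≤ x.1.2 then x.1.1 else x.2, if t < P.m₀ then 0 else
        if (if P.ℓ ≤ x.1.2 then x.1.1 else x.2) = x.1.1 then x.1.2 + 1 else 1)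
    exact (Measurable.of_discrete (f := g)).comp hdec

lemma state_congr (P : Params) (init : Fin h → Bool) (A : SemiCautious S h f) (σ : S)
    {w w' : ℕ → RoundNoise h f} (t : ℕ) (hw : ∀ s < t, w s = w' s) :
    state P init A σ w t = state P init A σ w' t := by
  induction t with
  | zero => rfl
  | succ t ih =>
    have hpast : (fun s : Fin t => w s) = fun s : Fin t => w' s :=
      funext fun s => hw s (s.2.trans t.lt_succ_self)
    funext j
    simp only [state, hpast, hw t t.lt_succ_self, ih fun s hs => hw s (hs.trans t.lt_succ_self)]

/-- The opinions of all nodes during round `t + 1`, of the honest and of the adversarial ones. -/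
def config (P : Params) (init : Fin h → Bool) (A : SemiCautious S h f) (t : ℕ)
    (p : S × (ℕ → RoundNoise h f)) : (Fin h → Bool) × (Fin f → Bool) :=
  (fun v => (state P init A p.1 p.2 t v).1, A.opinion t p.1 fun s : Fin t => p.2 s)

lemma measurable_config (P : Params) (init : Fin h → Bool) (A : SemiCautious S h f) (t : ℕ) :
    Measurable (config P init A t) := by
  refine Measurable.prodMk ?_ ?_
  · exact measurable_pi_lambda _ fun v =>
      measurable_fst.comp ((measurable_pi_apply v).comp (measurable_state P init A t))
  · exact (A.measurable_opinion t).comp (measurable_fst.prodMk (by fun_prop))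

lemma config_congr (P : Params) (init : Fin h → Bool) (A : SemiCautious S h f) (σ : S)
    {w w' : ℕ → RoundNoise h f} (t : ℕ) (hw : ∀ s < t, w s = w' s) :
    config P init A t (σ, w) = config P init A t (σ, w') := by
  have hpast : (fun s : Fin t => w s) = fun s : Fin t => w' s := funext fun s => hw s s.2
  simp only [config, state_congr P init A σ t hw, hpast]

end Measurability

/-! ### Independence of a round from its past -/

section Independence

variable {S Ω κ : Type*} [MeasurableSpace S] [MeasurableSpace Ω]

lemma infinitePi_inter_eval (P : Measure Ω) [IsProbabilityMeasure P] {t : ℕ}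
    {E : Set (ℕ → Ω)} (hE : MeasurableSet E)
    (hdep : ∀ w w' : ℕ → Ω, (∀ s < t, w s = w' s) → (w ∈ E ↔ w' ∈ E))
    {B : Set Ω} (hB : MeasurableSet B) :
    Measure.infinitePi (fun _ : ℕ => P) (E ∩ {w | w t ∈ B}) =
      Measure.infinitePi (fun _ : ℕ => P) E * P B := by
  have hΩ : Nonempty Ω := nonempty_of_isProbabilityMeasure P
  let x₀ : Ω := hΩ.some
  have hind : ProbabilityTheory.iIndepFun (fun (i : ℕ) (w : ℕ → Ω) => w i)
      (Measure.infinitePi fun _ : ℕ => P) :=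
    ProbabilityTheory.iIndepFun_infinitePi (X := fun _ x => x) fun _ => measurable_id
  have hfin := hind.indepFun_finset (Finset.range t) {t} (by simp) fun i => measurable_pi_apply i
  -- Padding with the constant `x₀` writes E as the preimage of a set of finite pasts, so that
  -- independence of disjoint finite blocks of coordinates applies.
  let ext : (Finset.range t → Ω) → ℕ → Ω := fun v i =>
    if hi : i ∈ Finset.range t then v ⟨i, hi⟩ else x₀
  have hext : Measurable ext := measurable_pi_lambda _ fun i => by
    by_cases hi : i ∈ Finset.range t
    · simp only [ext, dif_pos hi]
      exact measurable_pi_apply _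
    · simp only [ext, dif_neg hi]
      exact measurable_const
  have hmeas := hfin.measure_inter_preimage_eq_mul (ext ⁻¹' E)
    {v | v ⟨t, Finset.mem_singleton_self t⟩ ∈ B} (hext hE) (measurable_pi_apply _ hB)
  have hE' : (fun (w : ℕ → Ω) (i : Finset.range t) => w i) ⁻¹' (ext ⁻¹' E) = E := by
    ext w
    refine hdep _ _ fun s hs => ?_
    simp [ext, hs]
  rw [hE'] at hmeas
  have heval := (measurePreserving_eval_infinitePi (fun _ : ℕ => P) t).measure_preimage
    hB.nullMeasurableSet
  rw [← heval]
  exact hmeas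

lemma prod_infinitePi_inter_eval (ν : Measure S) [IsProbabilityMeasure ν] (P : Measure Ω)
    [IsProbabilityMeasure P] {t : ℕ} {E : Set (S × (ℕ → Ω))} (hE : MeasurableSet E)
    (hdep : ∀ (σ : S) (w w' : ℕ → Ω), (∀ s < t, w s = w' s) → ((σ, w) ∈ E ↔ (σ, w') ∈ E))
    {B : Set Ω} (hB : MeasurableSet B) :
    (ν.prod (Measure.infinitePi fun _ : ℕ => P)) (E ∩ {p | p.2 t ∈ B}) =
      (ν.prod (Measure.infinitePi fun _ : ℕ => P)) E * P B := by
  have hB' : MeasurableSet {p : S × (ℕ → Ω) | p.2 t ∈ B} :=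
    ((measurable_pi_apply t).comp measurable_snd) hB
  rw [Measure.prod_apply (hE.inter hB'), Measure.prod_apply hE,
    ← lintegral_mul_const _ (measurable_measure_prodMk_left hE)]
  refine lintegral_congr fun σ => ?_
  exact infinitePi_inter_eval P (measurable_prodMk_left hE) (hdep σ) hB

/-- If a random variable `C` with finitely many values depends only on the past of time `t`, and
the set `B c` has probability at most `g c` for each `c`, then the probability that the noise at
time `t` lies in `B C` is at most the mean value of `g C`. -/
lemma measureReal_mem_le_sum [Fintype κ] [MeasurableSpace κ] [MeasurableSingletonClass κ]
    (ν : Measure S) [IsProbabilityMeasure ν] (P : Measure Ω) [IsProbabilityMeasure P] {t : ℕ}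
    {C : S × (ℕ → Ω) → κ} (hC : Measurable C)
    (hdep : ∀ (σ : S) (w w' : ℕ → Ω), (∀ s < t, w s = w' s) → C (σ, w) = C (σ, w'))
    {B : κ → Set Ω} (hB : ∀ c, MeasurableSet (B c)) {g : κ → ℝ} (hg : ∀ c, P.real (B c) ≤ g c) :
    (ν.prod (Measure.infinitePi fun _ : ℕ => P)).real {p | p.2 t ∈ B (C p)} ≤
      ∑ c, (ν.prod (Measure.infinitePi fun _ : ℕ => P)).real (C ⁻¹' {c}) * g c := by
  have hset : {p : S × (ℕ → Ω) | p.2 t ∈ B (C p)} =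
      ⋃ c, (C ⁻¹' {c} ∩ {p | p.2 t ∈ B c}) := by
    ext p
    simp
  rw [hset]
  refine (measureReal_iUnion_fintype_le _).trans (Finset.sum_le_sum fun c _ => ?_)
  rw [measureReal_def, prod_infinitePi_inter_eval ν P (hC (measurableSet_singleton c))
    (fun σ w w' hw => by simp [hdep σ w w' hw]) (hB c), ENNReal.toReal_mul]
  exact mul_le_mul_of_nonneg_left (hg c) ENNReal.toReal_nonneg

/-- A random variable that depends on the past of time `t` only is outside of the set `U` with a
given probability; if the noise at time `t` has probability at most `ε` of being bad when the
variable is in `U`, and at most `θ + ε` otherwise, then it is bad with probability at most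
`θ ℙ[C ∉ U] + ε`. -/
lemma measureReal_mem_le [Fintype κ] [MeasurableSpace κ] [MeasurableSingletonClass κ]
    (ν : Measure S) [IsProbabilityMeasure ν] (P : Measure Ω) [IsProbabilityMeasure P] {t : ℕ}
    {C : S × (ℕ → Ω) → κ} (hC : Measurable C)
    (hdep : ∀ (σ : S) (w w' : ℕ → Ω), (∀ s < t, w s = w' s) → C (σ, w) = C (σ, w'))
    {B : κ → Set Ω} (hB : ∀ c, MeasurableSet (B c)) {θ ε : ℝ} {U : Set κ}
    (hU : ∀ c ∈ U, P.real (B c) ≤ ε) (hU' : ∀ c ∉ U, P.real (B c) ≤ θ + ε) :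
    (ν.prod (Measure.infinitePi fun _ : ℕ => P)).real {p | p.2 t ∈ B (C p)} ≤
      θ * (ν.prod (Measure.infinitePi fun _ : ℕ => P)).real {p | C p ∉ U} + ε := by
  classical
  refine (measureReal_mem_le_sum ν P hC hdep hB
    (g := fun c => (if c ∈ U then 0 else θ) + ε) fun c => ?_).trans (le_of_eq ?_)
  · by_cases hc : c ∈ U
    · simpa [hc] using hU c hc
    · simpa [hc] using hU' c hc
  · have hsum : ∀ s : Finset κ, ∑ c ∈ s,
        (ν.prod (Measure.infinitePi fun _ : ℕ => P)).real (C ⁻¹' {c}) =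
        (ν.prod (Measure.infinitePi fun _ : ℕ => P)).real (C ⁻¹' s) := fun s =>
      sum_measureReal_preimage_singleton s fun c _ => hC (measurableSet_singleton c)
    have hnot : {p | C p ∉ U} =
        C ⁻¹' ((Finset.univ.filter fun c => c ∉ U : Finset κ) : Set κ) := by
      ext p
      simp
    have htotal : ∑ c, (ν.prod (Measure.infinitePi fun _ : ℕ => P)).real (C ⁻¹' {c}) = 1 := by
      rw [hsum]
      simp
    simp_rw [mul_add, Finset.sum_add_distrib, ← Finset.sum_mul, htotal, one_mul]
    rw [hnot, ← hsum, Finset.sum_filter, Finset.mul_sum]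
    congr 1
    refine Finset.sum_congr rfl fun c _ => ?_
    split_ifs <;> simp_all [mul_comm]

end Independence

/-! ### Hoeffding bounds for the query targets -/

section Concentration

set_option linter.unusedSectionVars false

/-- The number of the first `N` queries that go to `W`. -/
def hits {α : Type*} [DecidableEq α] (W : Finset α) (N : ℕ) (q : ℕ → α) : ℕ :=
  ((Finset.range N).filter fun i => q i ∈ W).card

variable {α : Type*} [Fintype α] [DecidableEq α] [MeasurableSpace α] [DiscreteMeasurableSpace α]

lemma measurable_hits (W : Finset α) (N : ℕ) : Measurable (hits W N) :=
  measurable_card_filter_range (p := fun (q : ℕ → α) i => q i ∈ W)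
    (fun i => measurable_pi_apply i (MeasurableSet.of_discrete (s := (W : Set α)))) N

variable [Nonempty α]

lemma measureReal_uniform (W : Finset α) :
    (PMF.uniformOfFintype α).toMeasure.real (W : Set α) = (W.card : ℝ) / Fintype.card α := by
  rw [measureReal_def, PMF.toMeasure_uniformOfFintype_apply _ .of_discrete]
  simp

/-- Hoeffding's inequality for independent indicators, each sub-Gaussian with variance proxy 1/4. -/
lemma measureReal_hits_ge (W : Finset α) (N : ℕ) {s : ℝ} (hs : 0 ≤ s) :
    (Measure.infinitePi fun _ : ℕ => (PMF.uniformOfFintype α).toMeasure).real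
      {q | N * ((W.card : ℝ) / Fintype.card α) + s ≤ hits W N q} ≤ Real.exp (-2 * s ^ 2 / N) := by
  set μ := Measure.infinitePi fun _ : ℕ => (PMF.uniformOfFintype α).toMeasure with hμ
  let X : α → ℝ := (W : Set α).indicator 1
  have hX : Measurable X := .of_discrete
  have hXi : ∀ i : ℕ, Measurable fun q : ℕ → α => X (q i) := fun i =>
    hX.comp (measurable_pi_apply i)
  have hmean : ∀ i : ℕ, ∫ q, X (q i) ∂μ = (W.card : ℝ) / Fintype.card α := fun i => by
    have h1 := (measurePreserving_eval_infinitePi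
      (fun _ : ℕ => (PMF.uniformOfFintype α).toMeasure) i)
    have h2 := integral_map (μ := μ) (measurable_pi_apply i).aemeasurable
      (f := X) (by rw [h1.map_eq]; exact hX.aestronglyMeasurable)
    rw [← h2, h1.map_eq, integral_indicator_one .of_discrete, measureReal_uniform]
  have hind : ProbabilityTheory.iIndepFun
      (fun (i : ℕ) (q : ℕ → α) => X (q i) - (W.card : ℝ) / Fintype.card α) μ :=
    ProbabilityTheory.iIndepFun_infinitePi
      (X := fun _ x => X x - (W.card : ℝ) / Fintype.card α) fun _ => .of_discrete
  have hsub : ∀ i < N, ProbabilityTheory.HasSubgaussianMGF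
      (fun q : ℕ → α => X (q i) - (W.card : ℝ) / Fintype.card α) ((‖(1 : ℝ) - 0‖₊ / 2) ^ 2) μ :=
    fun i _ => by
      rw [← hmean i]
      refine ProbabilityTheory.hasSubgaussianMGF_of_mem_Icc (hXi i).aemeasurable
        (ae_of_all _ fun q => ?_)
      by_cases hq : q i ∈ W <;> simp [X, hq]
  have hmain := ProbabilityTheory.HasSubgaussianMGF.measure_sum_range_ge_le_of_iIndepFun
    hind hsub hs
  have hexp : -s ^ 2 / (2 * N * (((‖(1 : ℝ) - 0‖₊ / 2) ^ 2 : NNReal) : ℝ)) =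
      -2 * s ^ 2 / N := by
    simp only [sub_zero, nnnorm_one, NNReal.coe_pow, NNReal.coe_div, NNReal.coe_one,
      NNReal.coe_ofNat]
    rcases Nat.eq_zero_or_pos N with rfl | hN
    · simp
    · have : (N : ℝ) ≠ 0 := by positivity
      field_simp
  rw [hexp] at hmain
  refine le_of_eq_of_le (congrArg _ ?_) hmain
  ext q
  have hsum : ∑ i ∈ Finset.range N, (X (q i) - (W.card : ℝ) / Fintype.card α) =
      hits W N q - N * ((W.card : ℝ) / Fintype.card α) := by
    rw [Finset.sum_sub_distrib]
    simp [hits, X, Set.indicator_apply]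
  simp only [Set.mem_ofPred_eq, hsum]
  constructor <;> intro h <;> linarith

lemma measureReal_hits_le (W : Finset α) (N : ℕ) {s : ℝ} (hs : 0 ≤ s) :
    (Measure.infinitePi fun _ : ℕ => (PMF.uniformOfFintype α).toMeasure).real
      {q | (hits W N q : ℝ) ≤ N * ((W.card : ℝ) / Fintype.card α) - s} ≤
        Real.exp (-2 * s ^ 2 / N) := by
  -- Few hits of W are many hits of its complement.
  refine le_of_eq_of_le (congrArg _ ?_) (measureReal_hits_ge Wᶜ N hs)
  ext q
  have h1 : (hits W N q : ℝ) + hits Wᶜ N q = N := by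
    have := Finset.card_filter_add_card_filter_not (s := Finset.range N) (fun i => q i ∈ W)
    simp only [Finset.card_range] at this
    simp only [hits, Finset.mem_compl]
    exact_mod_cast this
  have h2 : ((Wᶜ.card : ℕ) : ℝ) / Fintype.card α = 1 - (W.card : ℝ) / Fintype.card α := by
    have : (Fintype.card α : ℝ) ≠ 0 := by positivity
    rw [Finset.card_compl, Nat.cast_sub (Finset.card_le_univ W)]
    field_simp
  simp only [Set.mem_ofPred_eq, h2]
  constructor <;> intro h <;> linarith

/-- The number of queries after which `k` of them are expected to have reached `W` or `Z`. -/
def expectedQueries (k : ℕ) (W Z : Finset α) : ℕ :=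
  ⌊(k : ℝ) * Fintype.card α / ((W.card : ℝ) + Z.card)⌋₊

/-- The queries `q` reach `W` too often or `Z` not often enough, by a deviation `s`. -/
def deviates (k : ℕ) (s : ℝ) (W Z : Finset α) : Set (ℕ → α) :=
  {q | (expectedQueries k W Z : ℝ) * ((W.card : ℝ) / Fintype.card α) + s ≤
      hits W (expectedQueries k W Z) q} ∪
  {q | (hits Z (expectedQueries k W Z) q : ℝ) ≤
      expectedQueries k W Z * ((Z.card : ℝ) / Fintype.card α) - s}

lemma measurableSet_deviates (k : ℕ) (s : ℝ) (W Z : Finset α) :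
    MeasurableSet (deviates k s W Z) :=
  (measurableSet_le measurable_const (measurable_from_top.comp (measurable_hits W _))).union
    (measurableSet_le (measurable_from_top.comp (measurable_hits Z _)) measurable_const)

lemma measureReal_deviates_le {k : ℕ} (hk : 1 ≤ k) {δ : ℝ} (hδ : 0 ≤ δ) {W Z : Finset α}
    (hWZ : Disjoint W Z) (hcard : (Fintype.card α : ℝ) ≤ 2 * ((W.card : ℝ) + Z.card)) :
    (Measure.infinitePi fun _ : ℕ => (PMF.uniformOfFintype α).toMeasure).real
      (deviates k (k * δ) W Z) ≤ 2 * Real.exp (-(k * δ ^ 2)) := by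
  have hn : (0 : ℝ) < Fintype.card α := by positivity
  have hM : (0 : ℝ) < (W.card : ℝ) + Z.card := by linarith
  have hle : (W.card : ℝ) + Z.card ≤ Fintype.card α := by
    rw [← Nat.cast_add, ← Finset.card_union_of_disjoint hWZ]
    exact_mod_cast Finset.card_le_univ _
  have hk' : (1 : ℝ) ≤ k := by exact_mod_cast hk
  have hN1 : 1 ≤ expectedQueries k W Z := by
    refine Nat.le_floor ?_
    rw [Nat.cast_one, le_div_iff₀ hM]
    nlinarith
  have hN1' : (1 : ℝ) ≤ expectedQueries k W Z := by exact_mod_cast hN1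
  -- As W and Z fill at least half of the nodes, at most 2k queries are considered, which turns
  -- Hoeffding's exponent 2(kδ)²/N into at least kδ².
  have hN2 : (expectedQueries k W Z : ℝ) ≤ 2 * k := by
    refine (Nat.floor_le (by positivity)).trans ?_
    rw [div_le_iff₀ hM]
    nlinarith
  have hexp : Real.exp (-2 * (k * δ) ^ 2 / expectedQueries k W Z) ≤
      Real.exp (-(k * δ ^ 2)) := by
    rw [Real.exp_le_exp, div_le_iff₀ (by linarith)]
    nlinarith [mul_le_mul_of_nonneg_left hN2 (by positivity : 0 ≤ (k : ℝ) * δ ^ 2)]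
  have hs : 0 ≤ (k : ℝ) * δ := by positivity
  refine (measureReal_union_le _ _).trans ?_
  linarith [measureReal_hits_ge W (expectedQueries k W Z) hs,
    measureReal_hits_le Z (expectedQueries k W Z) hs]

/-- After this many queries the mean numbers of hits of W and Z are k times their relative shares in
W ∪ Z; the -1 pays for rounding down. -/
lemma expectedQueries_bounds (k : ℕ) {W Z : Finset α} (hWZ : Disjoint W Z)
    (hM : (0 : ℝ) < (W.card : ℝ) + Z.card) :
    (expectedQueries k W Z : ℝ) * ((W.card : ℝ) / Fintype.card α) ≤
        k * ((W.card : ℝ) / ((W.card : ℝ) + Z.card)) ∧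
      k * ((Z.card : ℝ) / ((W.card : ℝ) + Z.card)) - 1 ≤
        expectedQueries k W Z * ((Z.card : ℝ) / Fintype.card α) := by
  have hn : (0 : ℝ) < Fintype.card α := by positivity
  have hle : (W.card : ℝ) + Z.card ≤ Fintype.card α := by
    rw [← Nat.cast_add, ← Finset.card_union_of_disjoint hWZ]
    exact_mod_cast Finset.card_le_univ _
  have h1 : (expectedQueries k W Z : ℝ) ≤ (k : ℝ) * Fintype.card α / ((W.card : ℝ) + Z.card) :=
    Nat.floor_le (by positivity)
  have h2 : (k : ℝ) * Fintype.card α / ((W.card : ℝ) + Z.card) <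
      (expectedQueries k W Z : ℝ) + 1 := Nat.lt_floor_add_one _
  have hW : (0 : ℝ) ≤ (W.card : ℝ) / Fintype.card α := by positivity
  have hZ : (0 : ℝ) ≤ (Z.card : ℝ) / Fintype.card α := by positivity
  have hZ1 : (Z.card : ℝ) / Fintype.card α ≤ 1 := by
    rw [div_le_one hn]
    linarith [(Nat.cast_nonneg W.card : (0 : ℝ) ≤ W.card)]
  constructor
  · refine (mul_le_mul_of_nonneg_right h1 hW).trans (le_of_eq ?_)
    field_simp
  · have h3 := mul_le_mul_of_nonneg_right h2.le hZ
    have h4 : (k : ℝ) * Fintype.card α / ((W.card : ℝ) + Z.card) *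
        ((Z.card : ℝ) / Fintype.card α) = k * ((Z.card : ℝ) / ((W.card : ℝ) + Z.card)) := by
      field_simp
    linarith

end Concentration

/-! ### What one node can see in a round -/

section Round

variable {h f : ℕ}

/-- The nodes with opinion `b`, when the opinions of the honest and adversarial nodes are `c`. -/
def holders (c : (Fin h → Bool) × (Fin f → Bool)) (b : Bool) : Finset (Node h f) :=
  (Finset.univ.filter fun v => c.1 v = b).disjSum (Finset.univ.filter fun v => c.2 v = b)

/-- The honest nodes with opinion `b`. -/
def honestHolders (c : (Fin h → Bool) × (Fin f → Bool)) (b : Bool) : Finset (Node h f) :=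
  (Finset.univ.filter fun v => c.1 v = b).disjSum ∅

/-- The proportion of the honest nodes with opinion `b` among all nodes except the adversarial
ones with the same opinion. -/
def lowerRatio (c : (Fin h → Bool) × (Fin f → Bool)) : ℝ :=
  ((honestHolders c true).card : ℝ) / ((holders c false).card + (honestHolders c true).card)

/-- The proportion of the nodes with opinion `1` among all nodes except the adversarial ones with
opinion `0`. -/
def upperRatio (c : (Fin h → Bool) × (Fin f → Bool)) : ℝ :=
  ((holders c true).card : ℝ) / ((holders c true).card + (honestHolders c false).card)

lemma disjoint_holders (c : (Fin h → Bool) × (Fin f → Bool)) (b : Bool) :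
    Disjoint (holders c b) (honestHolders c !b) := by
  rw [Finset.disjoint_left]
  rintro (v | v) <;> simp +contextual [holders, honestHolders]

lemma card_filter_bool {m : ℕ} (x : Fin m → Bool) (b : Bool) :
    (Finset.univ.filter fun v => x v = b).card + (Finset.univ.filter fun v => x v = !b).card =
      m := by
  have := Finset.card_filter_add_card_filter_not (s := (Finset.univ : Finset (Fin m)))
    (fun v => x v = b)
  simpa [← Bool.eq_not] using this

lemma card_holders_add (c : (Fin h → Bool) × (Fin f → Bool)) (b : Bool) :
    (holders c b).card + (honestHolders c !b).card =
      h + (Finset.univ.filter fun v => c.2 v = b).card := by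
  have := card_filter_bool c.1 b
  simp only [holders, honestHolders, Finset.card_disjSum, Finset.card_empty]
  omega

/-- The queries of one node give responses that are not representative of the opinions `c`. -/
def badQueries (k : ℕ) (s : ℝ) (c : (Fin h → Bool) × (Fin f → Bool)) : Set (ℕ → Node h f) :=
  deviates k s (holders c true) (honestHolders c false) ∪
    deviates k s (holders c false) (honestHolders c true)

lemma measurableSet_badQueries (k : ℕ) (s : ℝ) (c : (Fin h → Bool) × (Fin f → Bool)) :
    MeasurableSet (badQueries k s c) := by
  rcases isEmpty_or_nonempty (Node h f) with hn | hn
  · rw [Set.eq_empty_of_isEmpty (badQueries k s c)]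
    exact MeasurableSet.empty
  · exact (measurableSet_deviates _ _ _ _).union (measurableSet_deviates _ _ _ _)

lemma measureReal_badQueries_le [NeZero h] (hf : f ≤ h) {k : ℕ} (hk : 1 ≤ k) {δ : ℝ} (hδ : 0 ≤ δ)
    (c : (Fin h → Bool) × (Fin f → Bool)) :
    (Measure.infinitePi fun _ : ℕ => (PMF.uniformOfFintype (Node h f)).toMeasure).real
      (badQueries k (k * δ) c) ≤ 4 * Real.exp (-(k * δ ^ 2)) := by
  have key : ∀ b : Bool, (Measure.infinitePi fun _ : ℕ =>
      (PMF.uniformOfFintype (Node h f)).toMeasure).real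
      (deviates k (k * δ) (holders c b) (honestHolders c !b)) ≤ 2 * Real.exp (-(k * δ ^ 2)) :=
    fun b => by
      refine measureReal_deviates_le hk hδ (disjoint_holders c b) ?_
      have h1 := card_holders_add c b
      have h2 : Fintype.card (Node h f) ≤
          2 * ((holders c b).card + (honestHolders c !b).card) := by
        rw [Fintype.card_sum, Fintype.card_fin, Fintype.card_fin]
        omega
      exact_mod_cast h2
  refine (measureReal_union_le _ _).trans ?_
  have h1 := key true
  have h2 := key false
  simp only [Bool.not_true, Bool.not_false] at h1 h2
  linarith

variable {S : Type} [MeasurableSpace S]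

lemma response_eq_some (A : SemiCautious S h f) {t : ℕ} {σ : S} {past : Fin t → RoundNoise h f}
    {Q : Queries h f} {ξ : Fin h → Bool} {j : Fin h} {i : ℕ} {b : Bool}
    (hr : A.response t σ past Q ξ j i = some b) :
    Q j i ∈ holders (ξ, A.opinion t σ past) b := by
  unfold SemiCautious.response at hr
  rcases hQ : Q j i with v | v
  · simp only [hQ] at hr
    simpa [holders] using hr
  · simp only [hQ] at hr
    split_ifs at hr
    simpa [holders] using hr

lemma response_eq_some_of_mem (A : SemiCautious S h f) {t : ℕ} {σ : S}
    {past : Fin t → RoundNoise h f} {Q : Queries h f} {ξ : Fin h → Bool} {j : Fin h} {i : ℕ}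
    {b : Bool} (hQ : Q j i ∈ honestHolders (ξ, A.opinion t σ past) b) :
    A.response t σ past Q ξ j i = some b := by
  unfold SemiCautious.response
  rcases hQ' : Q j i with v | v
  · simpa [honestHolders, hQ'] using hQ
  · simp [honestHolders, hQ'] at hQ

/-- For the upper bound take W to be all holders of 1 and Z the honest holders of 0. Both
alternatives of `onesCount_upper` then give about k times `upperRatio`, because the shares of W and
Z add up to 1. The lower bound exchanges the opinions. -/
lemma onesCount_response_bounds [NeZero h] (A : SemiCautious S h f) {t : ℕ} {σ : S}
    {past : Fin t → RoundNoise h f} {Q : Queries h f} {ξ : Fin h → Bool} {j : Fin h} {k : ℕ}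
    {s : ℝ} (hQ : Q j ∉ badQueries k s (ξ, A.opinion t σ past)) :
    k * lowerRatio (ξ, A.opinion t σ past) - s - 1 <
        onesCount k (A.response t σ past Q ξ j) ∧
      (onesCount k (A.response t σ past Q ξ j) : ℝ) <
        k * upperRatio (ξ, A.opinion t σ past) + s + 1 := by
  set c := (ξ, A.opinion t σ past) with hc
  have hh : 0 < h := Nat.pos_of_ne_zero (NeZero.ne h)
  have hpos : ∀ b : Bool, (0 : ℝ) < ((holders c b).card : ℝ) + (honestHolders c !b).card :=
    fun b => by
      have := card_holders_add c b
      exact_mod_cast (by omega : 0 < (holders c b).card + (honestHolders c !b).card)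
  simp only [badQueries, deviates, Set.mem_union, Set.mem_ofPred_eq, not_or, not_le] at hQ
  obtain ⟨⟨h1, h2⟩, h3, h4⟩ := hQ
  obtain ⟨h5, h6⟩ := expectedQueries_bounds k (disjoint_holders c true) (hpos true)
  obtain ⟨h7, h8⟩ := expectedQueries_bounds k (disjoint_holders c false) (hpos false)
  have hp1 := hpos true
  have hp0 := hpos false
  simp only [Bool.not_true, Bool.not_false] at h5 h6 h7 h8 hp1 hp0
  have hup : (k : ℝ) * (((honestHolders c false).card : ℝ) /
      ((holders c true).card + (honestHolders c false).card)) = k - k * upperRatio c := by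
    unfold upperRatio
    field_simp
    ring
  have hlo : (k : ℝ) * (((holders c false).card : ℝ) /
      ((holders c false).card + (honestHolders c true).card)) = k - k * lowerRatio c := by
    unfold lowerRatio
    field_simp
    ring
  rw [hup] at h6
  rw [hlo] at h7
  change _ ≤ (k : ℝ) * upperRatio c at h5
  change (k : ℝ) * lowerRatio c - 1 ≤ _ at h8
  constructor
  · rcases onesCount_lower (k := k) (r := A.response t σ past Q ξ j)
      (expectedQueries k (holders c false) (honestHolders c true))
      (p := fun i => Q j i ∈ honestHolders c true) (z := fun i => Q j i ∈ holders c false)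
      (fun i => response_eq_some_of_mem A) (fun i => response_eq_some A) with hN | hN
    · have : (hits (honestHolders c true)
        (expectedQueries k (holders c false) (honestHolders c true)) (Q j) : ℝ) ≤
        onesCount k (A.response t σ past Q ξ j) := by exact_mod_cast hN
      linarith
    · have : (k : ℝ) ≤ onesCount k (A.response t σ past Q ξ j) + hits (holders c false)
        (expectedQueries k (holders c false) (honestHolders c true)) (Q j) := by
        exact_mod_cast hN
      linarith
  · rcases onesCount_upper (k := k) (r := A.response t σ past Q ξ j)
      (expectedQueries k (holders c true) (honestHolders c false))
      (p := fun i => Q j i ∈ holders c true) (z := fun i => Q j i ∈ honestHolders c false)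
      (fun i => response_eq_some A) (fun i => response_eq_some_of_mem A) with hN | hN
    · have : (onesCount k (A.response t σ past Q ξ j) : ℝ) ≤ hits (holders c true)
        (expectedQueries k (holders c true) (honestHolders c false)) (Q j) := by
        exact_mod_cast hN
      linarith
    · have : (onesCount k (A.response t σ past Q ξ j) : ℝ) + hits (honestHolders c false)
        (expectedQueries k (holders c true) (honestHolders c false)) (Q j) ≤ k := by
        exact_mod_cast hN
      linarith

end Round

/-! ### One round: reaching and preserving unanimity -/

section Step

variable {h f : ℕ}

/-- All honest nodes have the same opinion. -/
def Unanimous (c : (Fin h → Bool) × (Fin f → Bool)) : Prop :=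
  ∃ b, ∀ v, c.1 v = b

lemma card_holders_eq (c : (Fin h → Bool) × (Fin f → Bool)) (b : Bool) :
    (holders c b).card = (honestHolders c b).card +
      (Finset.univ.filter fun v => c.2 v = b).card := by
  simp [holders, honestHolders, Finset.card_disjSum]

lemma lowerRatio_eq (c : (Fin h → Bool) × (Fin f → Bool)) :
    lowerRatio c = ((honestHolders c true).card : ℝ) /
      ((h : ℝ) + (Finset.univ.filter fun v => c.2 v = false).card) := by
  have h1 := card_holders_add c false
  simp only [Bool.not_false] at h1
  rw [lowerRatio, ← Nat.cast_add, h1, Nat.cast_add]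

lemma upperRatio_eq (c : (Fin h → Bool) × (Fin f → Bool)) :
    upperRatio c = (((honestHolders c true).card : ℝ) +
      (Finset.univ.filter fun v => c.2 v = true).card) /
      ((h : ℝ) + (Finset.univ.filter fun v => c.2 v = true).card) := by
  have h1 := card_holders_add c true
  simp only [Bool.not_true] at h1
  rw [upperRatio, ← Nat.cast_add (holders c true).card, h1, card_holders_eq, Nat.cast_add,
    Nat.cast_add]

lemma le_lowerRatio [NeZero h] {q : ℝ} (hq : q < 1) (hf : (f : ℝ) ≤ q * ((h : ℝ) + f))
    {c : (Fin h → Bool) × (Fin f → Bool)} (hc : ∀ v, c.1 v = true) : 1 - q ≤ lowerRatio c := by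
  have hh : (0 : ℝ) < h := by exact_mod_cast Nat.pos_of_ne_zero (NeZero.ne h)
  have hF := card_filter_bool c.2 false
  have hF' : ((Finset.univ.filter fun v => c.2 v = false).card : ℝ) ≤ f := by
    exact_mod_cast (by omega : (Finset.univ.filter fun v => c.2 v = false).card ≤ f)
  have hH : (honestHolders c true).card = h := by simp [honestHolders, hc]
  rw [lowerRatio_eq, hH, le_div_iff₀ (by positivity)]
  nlinarith

lemma upperRatio_le [NeZero h] {q : ℝ} (hq : q < 1) (hf : (f : ℝ) ≤ q * ((h : ℝ) + f))
    {c : (Fin h → Bool) × (Fin f → Bool)} (hc : ∀ v, c.1 v = false) : upperRatio c ≤ q := by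
  have hh : (0 : ℝ) < h := by exact_mod_cast Nat.pos_of_ne_zero (NeZero.ne h)
  have hF := card_filter_bool c.2 true
  have hF' : ((Finset.univ.filter fun v => c.2 v = true).card : ℝ) ≤ f := by
    exact_mod_cast (by omega : (Finset.univ.filter fun v => c.2 v = true).card ≤ f)
  have hH : (honestHolders c true).card = 0 := by simp [honestHolders, hc]
  rw [upperRatio_eq, hH, Nat.cast_zero, zero_add, div_le_iff₀ (by positivity)]
  nlinarith

/-- The adversary cannot make both extreme values of the threshold undecided. -/
lemma upperRatio_le_of_lowerRatio_lt [NeZero h] {q β ε : ℝ} (hε : 0 ≤ ε)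
    (hβ : 6 * ε ≤ 1 - 2 * β - q * (1 - β)) (hβ1 : β + 3 * ε ≤ 1)
    (hf : (f : ℝ) ≤ q * ((h : ℝ) + f)) {c : (Fin h → Bool) × (Fin f → Bool)}
    (hc : lowerRatio c < β + 3 * ε) : upperRatio c ≤ 1 - β - 3 * ε := by
  have hh : (0 : ℝ) < h := by exact_mod_cast Nat.pos_of_ne_zero (NeZero.ne h)
  have hF : ((Finset.univ.filter fun v => c.2 v = true).card : ℝ) +
      (Finset.univ.filter fun v => c.2 v = false).card = f := by
    exact_mod_cast card_filter_bool c.2 true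
  rw [lowerRatio_eq, div_lt_iff₀ (by positivity)] at hc
  rw [upperRatio_eq, div_le_iff₀ (by positivity)]
  set F1 : ℝ := ((Finset.univ.filter fun v => c.2 v = true).card : ℝ)
  set F0 : ℝ := ((Finset.univ.filter fun v => c.2 v = false).card : ℝ)
  -- Inserting the bound on the honest ones from `hc`, the goal reduces to (β + 3ε)(F1 + F0) ≤ (1 -
  -- 2β - 6ε)h. Only the total f enters, not how the adversary splits its opinions; f ≤ q(h + f) and
  -- `hβ` then suffice.
  have h1 : (1 - β - 3 * ε) * f ≤ (1 - β - 3 * ε) * (q * ((h : ℝ) + f)) :=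
    mul_le_mul_of_nonneg_left hf (by linarith)
  have hfn : (0 : ℝ) ≤ f := Nat.cast_nonneg f
  have h2 : 6 * ε * ((h : ℝ) + f) ≤ (1 - 2 * β - q * (1 - β)) * ((h : ℝ) + f) :=
    mul_le_mul_of_nonneg_right hβ (by positivity)
  have hqn : 0 ≤ ε * (q * ((h : ℝ) + f)) := mul_nonneg hε (hfn.trans hf)
  have hf' : (f : ℝ) = F1 + F0 := hF.symm
  rw [hf'] at h1 h2 hqn
  nlinarith

/-- The noise of a round from which unanimity may not result, if the opinions are `c`. -/
def badNoise (β : ℝ) (k : ℕ) (ε : unitInterval) (c : (Fin h → Bool) × (Fin f → Bool)) :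
    Set (RoundNoise h f) :=
  {x | ∃ j, x.2 j ∈ badQueries k (k * ε) c} ∪
    {x | ¬ Unanimous c ∧ (β + 3 * ε ≤ lowerRatio c ∧ ε < x.1 ∨
      ¬ β + 3 * ε ≤ lowerRatio c ∧ x.1 < unitInterval.symm ε)}

lemma measurableSet_exists_badQueries (k : ℕ) (s : ℝ) (c : (Fin h → Bool) × (Fin f → Bool)) :
    MeasurableSet {x : RoundNoise h f | ∃ j, x.2 j ∈ badQueries k s c} := by
  have : {x : RoundNoise h f | ∃ j, x.2 j ∈ badQueries k s c} =
      ⋃ j, {x | x.2 j ∈ badQueries k s c} := by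
    ext x
    simp
  rw [this]
  exact MeasurableSet.iUnion fun j =>
    ((measurable_pi_apply j).comp measurable_snd) (measurableSet_badQueries k s c)

lemma measurableSet_badNoise (β : ℝ) (k : ℕ) (ε : unitInterval)
    (c : (Fin h → Bool) × (Fin f → Bool)) : MeasurableSet (badNoise β k ε c) := by
  refine (measurableSet_exists_badQueries _ _ _).union ?_
  refine (MeasurableSet.const _).inter (((MeasurableSet.const _).inter ?_).union
    ((MeasurableSet.const _).inter ?_))
  · exact measurable_fst measurableSet_Ioi
  · exact measurable_fst measurableSet_Iio

lemma roundLaw_real_queries [NeZero h] (j : Fin h) {E : Set (ℕ → Node h f)}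
    (hE : MeasurableSet E) :
    (roundLaw h f).real {x | x.2 j ∈ E} =
      (Measure.infinitePi fun _ : ℕ => (PMF.uniformOfFintype (Node h f)).toMeasure).real E := by
  have h1 : MeasurePreserving (fun x : RoundNoise h f => x.2 j) (roundLaw h f)
      (Measure.infinitePi fun _ : ℕ => (PMF.uniformOfFintype (Node h f)).toMeasure) :=
    (measurePreserving_eval _ j).comp measurePreserving_snd
  exact h1.measureReal_preimage hE.nullMeasurableSet

lemma roundLaw_real_threshold [NeZero h] {E : Set unitInterval} (hE : MeasurableSet E) :
    (roundLaw h f).real {x | x.1 ∈ E} = (volume : Measure unitInterval).real E := by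
  have h1 : MeasurePreserving (fun x : RoundNoise h f => x.1) (roundLaw h f) volume :=
    measurePreserving_fst
  exact h1.measureReal_preimage hE.nullMeasurableSet

lemma roundLaw_real_exists_badQueries_le [NeZero h] (hf : f ≤ h) {k : ℕ} (hk : 1 ≤ k) {δ : ℝ}
    (hδ : 0 ≤ δ) (c : (Fin h → Bool) × (Fin f → Bool)) :
    (roundLaw h f).real {x | ∃ j, x.2 j ∈ badQueries k (k * δ) c} ≤
      h * (4 * Real.exp (-(k * δ ^ 2))) := by
  have : {x : RoundNoise h f | ∃ j, x.2 j ∈ badQueries k (k * δ) c} =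
      ⋃ j, {x | x.2 j ∈ badQueries k (k * δ) c} := by
    ext x
    simp
  rw [this]
  refine (measureReal_iUnion_fintype_le _).trans ?_
  refine (Finset.sum_le_card_nsmul Finset.univ _ (4 * Real.exp (-(k * δ ^ 2))) fun j _ => ?_).trans
    (by simp)
  rw [roundLaw_real_queries j (measurableSet_badQueries _ _ _)]
  exact measureReal_badQueries_le hf hk hδ c

lemma roundLaw_real_badNoise_le_of_unanimous [NeZero h] (hf : f ≤ h) {k : ℕ} (hk : 1 ≤ k) (β : ℝ)
    (ε : unitInterval) {c : (Fin h → Bool) × (Fin f → Bool)} (hc : Unanimous c) :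
    (roundLaw h f).real (badNoise β k ε c) ≤ h * (4 * Real.exp (-(k * (ε : ℝ) ^ 2))) := by
  refine (measureReal_mono ?_).trans (roundLaw_real_exists_badQueries_le hf hk ε.2.1 c)
  simp [badNoise, hc]

/-- The opinions `c` decide which end of the threshold range is favourable, and the uniform number
falls within ε of that end with probability ε. -/
lemma roundLaw_real_badNoise_le [NeZero h] (hf : f ≤ h) {k : ℕ} (hk : 1 ≤ k) (β : ℝ)
    (ε : unitInterval) (c : (Fin h → Bool) × (Fin f → Bool)) :
    (roundLaw h f).real (badNoise β k ε c) ≤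
      (1 - ε) + h * (4 * Real.exp (-(k * (ε : ℝ) ^ 2))) := by
  have hthr : (roundLaw h f).real {x | ¬ Unanimous c ∧ (β + 3 * ε ≤ lowerRatio c ∧ ε < x.1 ∨
      ¬ β + 3 * ε ≤ lowerRatio c ∧ x.1 < unitInterval.symm ε)} ≤ 1 - ε := by
    have hε : (0 : ℝ) ≤ 1 - ε := sub_nonneg.mpr ε.2.2
    by_cases hlo : β + 3 * ε ≤ lowerRatio c
    · refine (measureReal_mono (s₂ := {x | x.1 ∈ Set.Ioi ε}) ?_).trans (le_of_eq ?_)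
      · rintro x ⟨-, ⟨-, hx⟩ | ⟨hx, -⟩⟩
        exacts [hx, absurd hlo hx]
      · rw [roundLaw_real_threshold measurableSet_Ioi, measureReal_def, unitInterval.volume_Ioi,
          ENNReal.toReal_ofReal hε]
    · refine (measureReal_mono (s₂ := {x | x.1 ∈ Set.Iio (unitInterval.symm ε)}) ?_).trans
        (le_of_eq ?_)
      · rintro x ⟨-, ⟨hx, -⟩ | ⟨-, hx⟩⟩
        exacts [absurd hx hlo, hx]
      · rw [roundLaw_real_threshold measurableSet_Iio, measureReal_def, unitInterval.volume_Iio,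
          ENNReal.toReal_ofReal (unitInterval.symm ε).2.1, unitInterval.coe_symm_eq]
  refine (measureReal_union_le _ _).trans ?_
  linarith [roundLaw_real_exists_badQueries_le hf hk ε.2.1 c]

variable {S : Type} [MeasurableSpace S]

lemma state_length_eq_zero (P : Params) (init : Fin h → Bool) (A : SemiCautious S h f) (σ : S)
    (w : ℕ → RoundNoise h f) {t : ℕ} (ht : t ≤ P.m₀) (j : Fin h) :
    (state P init A σ w t j).2 = 0 := by
  cases t with
  | zero => rfl
  | succ t => simp [state, Nat.lt_of_succ_le ht]

/-- In a round after the first one without bad noise, unanimity is reached or preserved, if no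
node has a final opinion. -/
lemma unanimous_succ [NeZero h] {P : Params} {q : ℝ} {ε : unitInterval} (hq : 0 ≤ q)
    (hqβ : 2 * (ε : ℝ) ≤ P.β - q) (hβ2 : P.β < 1 / 2)
    (hβ : 6 * (ε : ℝ) ≤ 1 - 2 * P.β - q * (1 - P.β))
    (hf : (f : ℝ) ≤ q * ((h : ℝ) + f)) (hkε : 1 ≤ (P.k : ℝ) * ε) (hℓ : 1 ≤ P.ℓ)
    (init : Fin h → Bool) (A : SemiCautious S h f) (p : S × (ℕ → RoundNoise h f)) {t : ℕ}
    (ht : 1 ≤ t) (htm : t ≤ P.m₀)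
    (hgood : p.2 t ∉ badNoise P.β P.k ε (config P init A t p)) :
    Unanimous (config P init A (t + 1) p) := by
  obtain ⟨σ, w⟩ := p
  have hε : (0 : ℝ) ≤ ε := ε.2.1
  have hk : (0 : ℝ) < P.k := by
    by_contra! hneg
    nlinarith
  have hx0 : (0 : ℝ) ≤ (w t).1 := (w t).1.2.1
  have hx1 : ((w t).1 : ℝ) ≤ 1 := (w t).1.2.2
  have hthr : P.threshold t ((w t).1 : ℝ) = P.β + (1 - P.β - P.β) * (w t).1 := by
    rw [Params.threshold, if_neg (by omega)]
  have hnew : ∀ v, (config P init A (t + 1) (σ, w)).1 v =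
      decide (P.threshold t ((w t).1 : ℝ) ≤ (onesCount P.k (A.response t σ
        (fun s : Fin t => w s) (w t).2 (config P init A t (σ, w)).1 v) : ℝ) / (P.k : ℝ)) :=
    fun v => by
      -- Run lengths are still 0 and ℓ ≥ 1, so no opinion is frozen and every node applies the
      -- threshold rule.
      have h0 := state_length_eq_zero P init A σ w htm v
      simp only [config, state, h0]
      rw [if_neg (by omega)]
      congr
  simp only [badNoise, Set.mem_union, Set.mem_ofPred_eq, not_or, not_exists] at hgood
  obtain ⟨hQ, hthreshold⟩ := hgood
  have hbounds : ∀ v, lowerRatio (config P init A t (σ, w)) - 2 * ε <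
        (onesCount P.k (A.response t σ (fun s : Fin t => w s) (w t).2
          (config P init A t (σ, w)).1 v) : ℝ) / P.k ∧
      (onesCount P.k (A.response t σ (fun s : Fin t => w s) (w t).2
          (config P init A t (σ, w)).1 v) : ℝ) / P.k <
        upperRatio (config P init A t (σ, w)) + 2 * ε := fun v => by
    -- The error kε + 1 is at most 2kε, by `hkε`.
    obtain ⟨h1, h2⟩ := onesCount_response_bounds A (hQ v)
    rw [lt_div_iff₀ hk, div_lt_iff₀ hk]
    change _ * lowerRatio (config P init A t (σ, w)) - _ - 1 < _ at h1
    change _ < _ * upperRatio (config P init A t (σ, w)) + _ + 1 at h2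
    constructor
    · exact lt_of_le_of_lt (by linarith) h1
    · exact lt_of_lt_of_le h2 (by linarith)
  have hone : P.threshold t ((w t).1 : ℝ) ≤ lowerRatio (config P init A t (σ, w)) - 2 * ε →
      Unanimous (config P init A (t + 1) (σ, w)) := fun hle =>
    ⟨true, fun v => by
      rw [hnew v, decide_eq_true_iff]
      exact hle.trans (hbounds v).1.le⟩
  have hzero : upperRatio (config P init A t (σ, w)) + 2 * ε ≤ P.threshold t ((w t).1 : ℝ) →
      Unanimous (config P init A (t + 1) (σ, w)) := fun hle =>
    ⟨false, fun v => by
      rw [hnew v, decide_eq_false_iff_not, not_le]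
      exact (hbounds v).2.trans_le hle⟩
  rw [hthr] at hone hzero
  by_cases hU : Unanimous (config P init A t (σ, w))
  · obtain ⟨b, hb⟩ := hU
    cases b with
    | true =>
      -- Even the largest threshold 1 - β is at most 1 - q - 2ε.
      have := le_lowerRatio (by linarith) hf hb
      exact hone (by nlinarith)
    | false =>
      have := upperRatio_le (by linarith) hf hb
      exact hzero (by nlinarith)
  · have hthreshold' := fun h => hthreshold ⟨hU, h⟩
    by_cases hlo : P.β + 3 * (ε : ℝ) ≤ lowerRatio (config P init A t (σ, w))
    · have hx : ((w t).1 : ℝ) ≤ ε := by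
        by_contra! hlt
        exact hthreshold' (Or.inl ⟨hlo, hlt⟩)
      exact hone (by nlinarith)
    · have hx : 1 - (ε : ℝ) ≤ (w t).1 := by
        by_contra! hlt
        exact hthreshold' (Or.inr ⟨hlo, hlt⟩)
      have := upperRatio_le_of_lowerRatio_lt hε hβ (by nlinarith) hf (not_le.mp hlo)
      exact hzero (by nlinarith)

end Step

/-! ### Iterating over the rounds and choosing the parameters -/

section Consensus

variable {h f : ℕ} {S : Type} [MeasurableSpace S]

lemma law_real_not_unanimous_succ_le [NeZero h] (ν : Measure S) [IsProbabilityMeasure ν]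
    {P : Params} {q : ℝ} {ε : unitInterval} (hq : 0 ≤ q)
    (hqβ : 2 * (ε : ℝ) ≤ P.β - q) (hβ2 : P.β < 1 / 2)
    (hβ : 6 * (ε : ℝ) ≤ 1 - 2 * P.β - q * (1 - P.β))
    (hf : (f : ℝ) ≤ q * ((h : ℝ) + f)) (hkε : 1 ≤ (P.k : ℝ) * ε) (hℓ : 1 ≤ P.ℓ)
    (init : Fin h → Bool) (A : SemiCautious S h f) {t : ℕ} (ht : 1 ≤ t) (htm : t ≤ P.m₀) :
    (law ν h f).real {p | ¬ Unanimous (config P init A (t + 1) p)} ≤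
      (1 - ε) * (law ν h f).real {p | ¬ Unanimous (config P init A t p)} +
        h * (4 * Real.exp (-(P.k * (ε : ℝ) ^ 2))) := by
  have hε : (0 : ℝ) ≤ ε := ε.2.1
  have hk : 1 ≤ P.k := Nat.one_le_iff_ne_zero.mpr fun h0 => by
    rw [h0, Nat.cast_zero, zero_mul] at hkε
    linarith
  have hfh : f ≤ h := by
    have : (f : ℝ) ≤ h := by nlinarith [(Nat.cast_nonneg h : (0 : ℝ) ≤ h),
      (Nat.cast_nonneg f : (0 : ℝ) ≤ f)]
    exact_mod_cast this
  refine (measureReal_mono (s₂ := {p | p.2 t ∈ badNoise P.β P.k ε (config P init A t p)})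
    fun p hp => ?_).trans ?_
  · by_contra hgood
    exact hp (unanimous_succ hq hqβ hβ2 hβ hf hkε hℓ init A p ht htm hgood)
  · exact measureReal_mem_le ν (roundLaw h f) (measurable_config P init A t)
      (fun σ _ _ hw => config_congr P init A σ t hw)
      (measurableSet_badNoise P.β P.k ε) (U := {c | Unanimous c})
      (fun c hc => roundLaw_real_badNoise_le_of_unanimous hfh hk P.β ε hc)
      (fun c _ => roundLaw_real_badNoise_le hfh hk P.β ε c)

lemma law_real_not_unanimous_le [NeZero h] (ν : Measure S) [IsProbabilityMeasure ν]
    {P : Params} {q : ℝ} {ε : unitInterval} (hε : (0 : ℝ) < ε) (hq : 0 ≤ q)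
    (hqβ : 2 * (ε : ℝ) ≤ P.β - q) (hβ2 : P.β < 1 / 2)
    (hβ : 6 * (ε : ℝ) ≤ 1 - 2 * P.β - q * (1 - P.β))
    (hf : (f : ℝ) ≤ q * ((h : ℝ) + f)) (hkε : 1 ≤ (P.k : ℝ) * ε) (hℓ : 1 ≤ P.ℓ)
    (init : Fin h → Bool) (A : SemiCautious S h f) {t : ℕ} (htm : t ≤ P.m₀) :
    (law ν h f).real {p | ¬ Unanimous (config P init A (t + 1) p)} ≤
      (1 - ε) ^ t + h * (4 * Real.exp (-(P.k * (ε : ℝ) ^ 2))) / ε := by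
  induction t with
  | zero =>
    rw [pow_zero]
    -- Nothing is claimed about round 1, whose threshold lies in [a, b]; contraction starts with
    -- round 2.
    exact measureReal_le_one.trans (le_add_of_nonneg_right (by positivity))
  | succ t ih =>
    refine (law_real_not_unanimous_succ_le ν hq hqβ hβ2 hβ hf hkε hℓ init A
      (Nat.succ_pos t) htm).trans ?_
    refine (add_le_add_left (mul_le_mul_of_nonneg_left (ih (by omega))
      (sub_nonneg.mpr ε.2.2)) _).trans (le_of_eq ?_)
    -- With e the error of one round, e/ε is the fixed point of x ↦ (1 - ε)x + e.
    field_simp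
    ring

/-- If the opinions coincide after round `m₀ + 1`, they are final when one round suffices. -/
lemma consensus_of_unanimous [NeZero h] {P : Params} (hℓ : P.ℓ = 1) (init : Fin h → Bool)
    (A : SemiCautious S h f) {p : S × (ℕ → RoundNoise h f)}
    (hU : Unanimous (config P init A (P.m₀ + 1) p)) :
    (ConsensusOn P init A p.1 p.2 false ∨ ConsensusOn P init A p.1 p.2 true) ∧
      numRounds P init A p.1 p.2 ≤ ((P.m₀ + 1 : ℕ) : ℕ∞) := by
  have hfinal : ∀ j, P.ℓ ≤ (state P init A p.1 p.2 (P.m₀ + 1) j).2 := fun j => by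
    simp only [state, lt_irrefl, if_false, hℓ]
    split_ifs <;> omega
  obtain ⟨b, hb⟩ := hU
  have hcons : ConsensusOn P init A p.1 p.2 b := fun j => ⟨P.m₀ + 1, hfinal j, hb j⟩
  refine ⟨?_, iInf₂_le (P.m₀ + 1) hfinal⟩
  cases b
  exacts [Or.inl hcons, Or.inr hcons]

/-- With x = ⌊√n⌋ + 1 one has n ≤ x², and x² exp(-ε²x) tends to 0. -/
lemma tendsto_failure_bound {ε : ℝ} (hε : 0 < ε) (hε1 : ε ≤ 1) :
    Tendsto (fun n : ℕ => (1 - ε) ^ (n + 1) +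
      (n : ℝ) * (4 * Real.exp (-(((Nat.sqrt n + 1 : ℕ) : ℝ) * ε ^ 2))) / ε) atTop (𝓝 0) := by
  have h1 : Tendsto (fun n : ℕ => (1 - ε) ^ (n + 1)) atTop (𝓝 0) :=
    (tendsto_pow_atTop_nhds_zero_of_lt_one (by linarith) (by linarith)).comp
      (tendsto_add_atTop_nat 1)
  have hm : Tendsto (fun n : ℕ => ((Nat.sqrt n + 1 : ℕ) : ℝ)) atTop atTop := by
    refine tendsto_natCast_atTop_atTop.comp (tendsto_atTop.mpr fun b => ?_)
    filter_upwards [eventually_ge_atTop (b * b)] with n hn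
    exact (Nat.le_sqrt.mpr hn).trans (Nat.le_succ _)
  have h2 : Tendsto (fun x : ℝ => 4 / ε * (x ^ 2 * Real.exp (-(ε ^ 2 * x)))) atTop (𝓝 0) := by
    have := (Real.tendsto_pow_mul_exp_neg_atTop_nhds_zero 2).comp
      (tendsto_id.const_mul_atTop (by positivity : 0 < ε ^ 2))
    have := this.const_mul (4 / ε / (ε ^ 2) ^ 2)
    rw [mul_zero] at this
    refine this.congr fun x => ?_
    simp only [Function.comp, id]
    field_simp
  have h3 := h2.comp hm
  rw [← add_zero (0 : ℝ)]
  refine h1.add (squeeze_zero (fun n => by positivity) (fun n => ?_) h3)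
  have hn : (n : ℝ) ≤ ((Nat.sqrt n + 1 : ℕ) : ℝ) ^ 2 := by
    have := Nat.lt_succ_sqrt n
    rw [pow_two]
    exact_mod_cast this.le
  simp only [Function.comp]
  have he : 0 < Real.exp (-(((Nat.sqrt n + 1 : ℕ) : ℝ) * ε ^ 2)) := Real.exp_pos _
  calc (n : ℝ) * (4 * Real.exp (-(((Nat.sqrt n + 1 : ℕ) : ℝ) * ε ^ 2))) / ε
      ≤ ((Nat.sqrt n + 1 : ℕ) : ℝ) ^ 2 *
          (4 * Real.exp (-(((Nat.sqrt n + 1 : ℕ) : ℝ) * ε ^ 2))) / ε := by gcongr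
    _ = _ := by
      rw [mul_comm (ε ^ 2)]
      ring

lemma tendsto_sqrt_add_one_div :
    Tendsto (fun n : ℕ => ((Nat.sqrt n + 1 : ℕ) : ℝ) / (n : ℝ)) atTop (𝓝 0) := by
  have h1 : Tendsto (fun n : ℕ => 1 / √(n : ℝ) + 1 / (n : ℝ)) atTop (𝓝 0) := by
    rw [← add_zero (0 : ℝ)]
    refine Tendsto.add ?_ tendsto_one_div_atTop_nhds_zero_nat
    simp_rw [one_div]
    exact tendsto_inv_atTop_zero.comp (Real.tendsto_sqrt_atTop.comp tendsto_natCast_atTop_atTop)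
  refine squeeze_zero' (Eventually.of_forall fun n => by positivity) ?_ h1
  filter_upwards [eventually_gt_atTop 0] with n hn
  have hn' : (0 : ℝ) < n := by exact_mod_cast hn
  rw [Nat.cast_add, Nat.cast_one, add_div, ← Real.sqrt_div_self']
  gcongr
  exact Real.nat_sqrt_le_real_sqrt

lemma worksWhp_of_lt {q β : ℝ} (hq : 0 ≤ q) (hqβ : q < β) (hβ : β < 1 / 2)
    (hqβ' : q < 2 - 1 / (1 - β)) : WorksWhp q β := by
  have hgap : 0 < 1 - 2 * β - q * (1 - β) := by
    have hβ1 : 0 < 1 - β := by linarith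
    have := mul_lt_mul_of_pos_right hqβ' hβ1
    rw [sub_mul, one_div, inv_mul_cancel₀ hβ1.ne'] at this
    linarith
  -- The margin must fit 2δ into β - q (preservation) and 6δ into 1 - 2β - q(1 - β) (creation of
  -- unanimity).
  obtain ⟨δ, hδ0, hδ⟩ : ∃ δ : ℝ, 0 < δ ∧
      δ < min 1 (min ((β - q) / 2) ((1 - 2 * β - q * (1 - β)) / 6)) :=
    exists_between (lt_min one_pos (lt_min (by linarith) (by linarith)))
  rw [lt_min_iff, lt_min_iff] at hδ
  let ε : unitInterval := ⟨δ, hδ0.le, hδ.1.le⟩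
  -- k of order √n is o(n) yet beats the union bound over the nodes; m₀ = n + 1 makes (1 - δ)^m₀
  -- vanish; ℓ = u = 1.
  refine ⟨fun n => Nat.sqrt n + 1, fun n => n + 1, fun _ => 1, fun _ => 1,
    fun n => ⟨Nat.succ_pos _, Nat.succ_pos _, le_rfl⟩, tendsto_sqrt_add_one_div,
    fun η hη => ?_⟩
  obtain ⟨N, hN⟩ := eventually_atTop.mp
    ((tendsto_failure_bound hδ0 hδ.1.le).eventually_le_const hη)
  obtain ⟨K, hK⟩ := exists_nat_ge (1 / δ)
  refine ⟨max N (K * K), fun n hn h f _ hhf hf a b _ _ _ S _ ν _ A init => ?_⟩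
  intro P
  have hkδ : 1 ≤ ((Nat.sqrt n + 1 : ℕ) : ℝ) * δ := by
    have hKn : K ≤ Nat.sqrt n + 1 :=
      (Nat.le_sqrt.mpr ((le_max_right _ _).trans hn)).trans (Nat.le_succ _)
    rw [← div_le_iff₀ hδ0]
    exact hK.trans (by exact_mod_cast hKn)
  have hn' : (h : ℝ) + f = n := by exact_mod_cast hhf
  have hbound := law_real_not_unanimous_le ν (P := P) (q := q) (ε := ε) hδ0 hq
    (by change 2 * δ ≤ β - q; linarith) hβ
    (by change 6 * δ ≤ 1 - 2 * β - q * (1 - β); linarith) (by rwa [hn']) hkδ le_rfl init A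
    (t := P.m₀) le_rfl
  have hhn : (h : ℝ) ≤ n := by exact_mod_cast (by omega : h ≤ n)
  have hfail : (law ν h f).real {p | ¬ Unanimous (config P init A (P.m₀ + 1) p)} ≤ η := by
    refine hbound.trans (le_trans ?_ (hN n ((le_max_left _ _).trans hn)))
    change (1 - δ) ^ (n + 1) +
      (h : ℝ) * (4 * Real.exp (-(((Nat.sqrt n + 1 : ℕ) : ℝ) * δ ^ 2))) / δ ≤ _
    gcongr
  have hcover : (1 : ℝ) ≤ (law ν h f).real {p | ¬ Unanimous (config P init A (P.m₀ + 1) p)} +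
      (law ν h f).real {p | Unanimous (config P init A (P.m₀ + 1) p)} := by
    refine le_trans (le_of_eq ?_) (measureReal_union_le _ _)
    rw [← probReal_univ (μ := law ν h f)]
    congr 1
    ext p
    simp [or_comm, em]
  have hmono : (law ν h f).real {p | Unanimous (config P init A (P.m₀ + 1) p)} ≤
      (law ν h f).real {ω | (ConsensusOn P init A ω.1 ω.2 false ∨
        ConsensusOn P init A ω.1 ω.2 true) ∧
        numRounds P init A ω.1 ω.2 ≤ ((P.m₀ + 1 * 1 : ℕ) : ℕ∞)} :=
    measureReal_mono fun p hp => consensus_of_unanimous rfl init A hp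
  change 1 - η ≤ (law ν h f).real {ω | (ConsensusOn P init A ω.1 ω.2 false ∨
        ConsensusOn P init A ω.1 ω.2 true) ∧
        numRounds P init A ω.1 ω.2 ≤ ((P.m₀ + 1 * 1 : ℕ) : ℕ∞)}
  linarith

end Consensus

/-! ### The constraints on q and β, and the golden ratio -/

section Threshold

lemma sqrt_five_bounds : 2.236 < √5 ∧ √5 < 2.237 := by
  constructor
  · exact Real.lt_sqrt_of_sq_lt (by norm_num)
  · rw [Real.sqrt_lt' (by norm_num)]
    norm_num

lemma sqrt_five_sq : √(5 : ℝ) ^ 2 = 5 := Real.sq_sqrt (by norm_num)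

lemma lt_sub_one_div_iff {q β : ℝ} (hβ : β < 1) :
    q < 2 - 1 / (1 - β) ↔ q * (1 - β) < 1 - 2 * β := by
  have hβ1 : 0 < 1 - β := by linarith
  rw [lt_sub_comm, div_lt_iff₀ hβ1]
  constructor <;> intro h <;> linarith

lemma one_div_sub_lt_iff {q β : ℝ} (hqβ : q < β) (hβ : β < 1 / 2) :
    1 / (2 - q) - β < 1 - 2 * β ↔ q < 2 - 1 / (1 - β) := by
  have hβ1 : 0 < 2 - q := by linarith
  rw [lt_sub_one_div_iff (by linarith), sub_lt_iff_lt_add, div_lt_iff₀ hβ1]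
  constructor <;> intro h <;> linarith

lemma eventually_constraint {q β c : ℝ} (h : 1 / (2 - q) - β < 1 - 2 * β) :
    ∃ K : ℕ, ∀ k : ℕ, K ≤ k → 1 / (2 - q) - β + √(2 * (k : ℝ)⁻¹ * c) < 1 - 2 * β := by
  have h1 : Tendsto (fun k : ℕ => 1 / (2 - q) - β + √(2 * (k : ℝ)⁻¹ * c)) atTop
      (𝓝 (1 / (2 - q) - β + √(2 * 0 * c))) :=
    (((tendsto_inv_atTop_nhds_zero_nat.const_mul 2).mul_const c).sqrt).const_add _
  rw [mul_zero, zero_mul, Real.sqrt_zero, add_zero] at h1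
  exact eventually_atTop.mp (h1.eventually_lt_const h)

lemma eq_two_sub_one_div_iff {β : ℝ} (hβ : β < 1 / 2) :
    β = 2 - 1 / (1 - β) ↔ β = (3 - √5) / 2 := by
  have hβ1 : 1 - β ≠ 0 := by linarith
  have h5 := sqrt_five_sq
  have hb := sqrt_five_bounds
  rw [eq_sub_iff_add_eq, ← eq_sub_iff_add_eq', div_eq_iff hβ1]
  constructor
  · intro h
    -- This is β² - 3β + 1 = 0; the other root exceeds 1/2.
    have hfac : (β - (3 - √5) / 2) * (β - (3 + √5) / 2) = 0 := by linear_combination -h - h5 / 4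
    rcases mul_eq_zero.mp hfac with h0 | h0 <;> linarith [hb.1]
  · rintro rfl
    linear_combination -h5 / 4

lemma lt_threshold_of_constraints {q β : ℝ} (hβ : β < 1 / 2) (hqβ : q < β)
    (h : q < 2 - 1 / (1 - β)) : q < (3 - √5) / 2 := by
  rw [lt_sub_one_div_iff (by linarith)] at h
  have h5 := sqrt_five_sq
  have hb := sqrt_five_bounds
  by_contra! hq
  nlinarith

/-- At β = φ⁻² both upper limits for q equal φ⁻², so the strict inequalities hold there and persist
nearby by continuity. -/
lemma eventually_constraints {q : ℝ} (hq : q < (3 - √5) / 2) :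
    ∃ δ : ℝ, 0 < δ ∧ ∀ β : ℝ, |β - (3 - √5) / 2| < δ →
      0 < β ∧ β < 1 / 2 ∧ q < β ∧ q < 2 - 1 / (1 - β) := by
  have hb := sqrt_five_bounds
  have hfix : (3 - √5) / 2 = 2 - 1 / (1 - (3 - √5) / 2) :=
    (eq_two_sub_one_div_iff (by linarith [hb.1])).mpr rfl
  have hcont : ContinuousAt (fun β : ℝ => 2 - 1 / (1 - β)) ((3 - √5) / 2) := by
    refine continuousAt_const.sub (continuousAt_const.div (by fun_prop) ?_)
    linarith [hb.1]
  have hev : ∀ᶠ β in 𝓝 ((3 - √5) / 2), 0 < β ∧ β < 1 / 2 ∧ q < β ∧ q < 2 - 1 / (1 - β) := by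
    filter_upwards [lt_mem_nhds (by linarith [hb.2] : 0 < (3 - √5) / 2),
      gt_mem_nhds (by linarith [hb.1] : (3 - √5) / 2 < 1 / 2), lt_mem_nhds hq,
      hcont.eventually_const_lt (hq.trans_eq hfix)] with β h1 h2 h3 h4
    exact ⟨h1, h2, h3, h4⟩
  obtain ⟨δ, hδ, hball⟩ := Metric.eventually_nhds_iff.mp hev
  exact ⟨δ, hδ, fun β hβ => hball (by rwa [Real.dist_eq])⟩

end Threshold

end FPC

end

theorem mainTheorem6 :
    -- the threshold
    (Real.goldenRatio⁻¹ ^ 2 = (3 - √5) / 2 ∧ 1 / (1 + Real.goldenRatio) = (3 - √5) / 2 ∧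
      |(3 - √5) / 2 - 0.38| < 0.005) ∧
    -- the constraint on the parameters, and when it can be met by taking `k` large
    (∀ q β : ℝ, 0 ≤ q → q < β → β < 1 / 2 →
      (1 / (2 - q) - β < 1 - 2 * β ↔ q < 2 - 1 / (1 - β)) ∧
      (q < 2 - 1 / (1 - β) ↔ ∃ k : ℕ, 1 ≤ k ∧
        1 / (2 - q) - β + √(2 * (k : ℝ)⁻¹ * Real.log (4 * (1 - q) / (β - q))) < 1 - 2 * β) ∧
      (q < 2 - 1 / (1 - β) ↔ ∃ K : ℕ, ∀ k : ℕ, K ≤ k →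
        1 / (2 - q) - β + √(2 * (k : ℝ)⁻¹ * Real.log (4 * (1 - q) / (β - q))) < 1 - 2 * β)) ∧
    -- the two constraints give the threshold
    (∀ β : ℝ, 0 < β → β < 1 / 2 → (β = 2 - 1 / (1 - β) ↔ β = (3 - √5) / 2)) ∧
    (∀ q : ℝ, 0 ≤ q → ((∃ β : ℝ, 0 < β ∧ β < 1 / 2 ∧ q < β ∧ q < 2 - 1 / (1 - β)) ↔
      q < (3 - √5) / 2)) ∧
    -- the protocol works whp under the two constraints
    (∀ q β : ℝ, 0 ≤ q → q < β → β < 1 / 2 → q < 2 - 1 / (1 - β) → FPC.WorksWhp q β) ∧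
    -- below the threshold it can be tuned to work whp, and any `β` close to the threshold will do
    (∀ q : ℝ, 0 ≤ q → q < (3 - √5) / 2 →
      ∃ δ : ℝ, 0 < δ ∧ ∀ β : ℝ, |β - (3 - √5) / 2| < δ →
        0 < β ∧ β < 1 / 2 ∧ q < β ∧ q < 2 - 1 / (1 - β) ∧ FPC.WorksWhp q β) := by
  have hb := FPC.sqrt_five_bounds
  have h5 := FPC.sqrt_five_sq
  refine ⟨⟨?_, ?_, ?_⟩, fun q β hq hqβ hβ => ?_, fun β _ hβ => FPC.eq_two_sub_one_div_iff hβ,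
    fun q hq => ⟨?_, fun h => ?_⟩, fun q β => FPC.worksWhp_of_lt, fun q hq h => ?_⟩
  · rw [Real.inv_goldenRatio, Real.goldenConj]
    linear_combination h5 / 4
  · rw [Real.goldenRatio, div_eq_iff (by positivity)]
    linear_combination h5 / 4
  · rw [abs_lt]
    constructor <;> linarith [hb.1, hb.2]
  · have hiff := FPC.one_div_sub_lt_iff hqβ hβ
    -- The square root only strengthens the constraint. This includes k = 0, where 0⁻¹ = 0 makes the
    -- root vanish.
    have hback : ∀ k : ℕ,
        1 / (2 - q) - β + √(2 * (k : ℝ)⁻¹ * Real.log (4 * (1 - q) / (β - q))) < 1 - 2 * β →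
        q < 2 - 1 / (1 - β) := fun k hk =>
      hiff.mp ((le_add_of_nonneg_right (Real.sqrt_nonneg _)).trans_lt hk)
    refine ⟨hiff, ⟨fun h => ?_, fun ⟨k, _, hk⟩ => hback k hk⟩,
      fun h => FPC.eventually_constraint (hiff.mpr h), fun ⟨K, hK⟩ => hback K (hK K le_rfl)⟩
    obtain ⟨K, hK⟩ := FPC.eventually_constraint (c := Real.log (4 * (1 - q) / (β - q)))
      (hiff.mpr h)
    exact ⟨K + 1, Nat.succ_pos K, hK (K + 1) (Nat.le_succ K)⟩
  · rintro ⟨β, _, hβ, hqβ, h⟩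
    exact FPC.lt_threshold_of_constraints hβ hqβ h
  · obtain ⟨δ, hδ, hall⟩ := FPC.eventually_constraints h
    exact ⟨_, hall _ (by rwa [sub_self, abs_zero])⟩
  · obtain ⟨δ, hδ, hall⟩ := FPC.eventually_constraints h
    refine ⟨δ, hδ, fun β hβ => ?_⟩
    obtain ⟨h1, h2, h3, h4⟩ := hall β hβ
    exact ⟨h1, h2, h3, h4, FPC.worksWhp_of_lt hq h3 h2 h4⟩
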